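/- **Setting.** Let $V$ be a real Hilbert space of (vector-valued) wave profiles and $V'$ its dual, the duality pairing $\langle\cdot,\cdot\rangle$ playing the role of the inner product $\int f\cdot g\,d\mathbf x$ of square-integrable functions (e.g. $V=H^1(\mathbb R^N;\mathbb R^m)\subset L^2\subset V'=H^{-1}$, or a finite-dimensional space after discretization). Let $\mathbf M:V\to V'$ be a bounded invertible operator (the acceleration operator) that is Hermitian, $\langle \mathbf Mv,w\rangle=\langle \mathbf Mw,v\rangle$, and positive definite, $\langle \mathbf Mv,v\rangle>0$ for $v\ne0$. Let $\mathbf L_0:V\to V'$ be a (nonlinear) operator, let $\mathbf L_1(v):V\to V'$ be its linearization (derivative) at $v$, and let $\mathbf L_1^\dagger$ be the Hermitian adjoint, $\langle \mathbf L_1^\dagger v,w\rangle=\langle \mathbf L_1w,v\rangle$. For $\Delta t>0$ the squared-operator method (SOM) is the iteration $$u_{n+1}=u_n-\left[\mathbf M^{-1}\mathbf L_1(v)^\dagger \mathbf M^{-1}\mathbf L_0v\right]_{v=u_n}\Delta t .$$ **Assumptions.** Let $u(c)$ be a continuously differentiable family of solutions of $\mathbf L_0u(c)=0$, for $c=(c_1,\dots,c_s)\in\mathbb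 R^s$ ($s\ge 0$) near $c^0$, and $u=u(c^0)$. Assume that $\mathbf L_0(v+w)=\mathbf L_0v+\mathbf L_1(v)w+O(\|w\|^2)$ uniformly for $v$ near $u$, and that the kernel of $\mathbf L_1=\mathbf L_1(u)$ is spanned by the invariance modes $\partial u/\partial c_j$, $1\le j\le s$, at $c=c^0$. Let $$\mathcal L=-\mathbf M^{-1}\mathbf L_1^\dagger\mathbf M^{-1}\mathbf L_1:V\to V,$$ let $\Lambda_{min}$ be the smallest eigenvalue of $\mathcal L$, continuous spectrum included (the smallest element of its spectrum); suppose $\Lambda_{min}\neq0$ and put $\Delta t_{max}=-2/\Lambda_{min}$. **Theorem.** 1. Suppose that the non-zero part of the spectrum of $\mathcal L$ is bounded away from $0$. If $0<\Delta t<\Delta t_{max}$, then SOM converges from nearby initial data: for every $\varepsilon>0$ there is $\delta>0$ such that for every $u_0$ with $\|u_0-u\|<\delta$ all iterates satisfy $\|u_n-u\|<\varepsilon$, and $u_n\to u(c)$ for some $c$ with $|c-c^0|<\varepsilon$ and $\mathbf L_0u(c)=0$ (that is, $u_n$ tends to the solitary wave with slightly shifted free parameters; to $u$ itself if $s=0$).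 2. If $\Delta t>\Delta t_{max}$, then SOM diverges from $u$: there is $\varepsilon>0$ such that for every $\delta>0$ there are an initial condition $u_0$ with $\|u_0-u\|<\delta$ and an $n$ for which $u_n$ has distance at least $\varepsilon$ from $u$ and from every other solution $v$ of $\mathbf L_0v=0$. 3. If moreover $\Lambda_{min}$ is an isolated point of the spectrum of $\mathcal L$ (as it always is in finite dimension), then for $\Delta t>\Delta t_{max}$ SOM diverges for generic initial data: there is $\varepsilon>0$ such that the set of those $u_0$ for which $\|u_n-u\|<\varepsilon$ for all $n\ge 0$ has empty interior. -/

import Mathlib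

open Filter Topology

noncomputable section

/-!
Setting.  `V` is a real Hilbert space of (vector-valued) wave profiles, the energy space of the
acceleration operator, and `StrongDual ℝ V` is its dual for the pairing that extends the
inner product `⟨f, g⟩ = ∫ f · g dx` (the model case is `H¹ ⊂ L² ⊂ H⁻¹`; for a discretized equation
`V` is finite dimensional).  The operators of the wave equation and the acceleration operator
act from `V` to its dual.
-/

namespace SquaredOperator

variable {V : Type*} [NormedAddCommGroup V] [InnerProductSpace ℝ V]

/-- `M` is Hermitian and positive definite for the pairing of `V` with its dual.  (Its invertibility
is part of its type.) -/
structure IsAcceleration (M : V ≃L[ℝ] StrongDual ℝ V) : Prop where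
  hermitian : ∀ v w : V, M v w = M w v
  posDef : ∀ v : V, v ≠ 0 → 0 < M v v

/-- The linearized operator `L₁` of `L₀` at the profile `v`. -/
def linearized (L₀ : V → StrongDual ℝ V) (v : V) : V →L[ℝ] StrongDual ℝ V :=
  fderiv ℝ L₀ v

/-- The Hermitian adjoint of an operator for the pairing of `V` with its dual:
`⟨T† v, w⟩ = ⟨v, T w⟩`. -/
def dagger (T : V →L[ℝ] StrongDual ℝ V) : V →L[ℝ] StrongDual ℝ V :=
  T.flip

theorem dagger_apply (T : V →L[ℝ] StrongDual ℝ V) (v w : V) : dagger T v w = T w v := rfl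

/-- Linearization with quadratic error, `L₀ (v + w) = L₀ v + L₁ w + O(‖w‖²)`, at the profiles `v`
near `u`. -/
def IsLinearizableNear (L₀ : V → StrongDual ℝ V) (u : V) : Prop :=
  ∃ r > 0, ∃ C : ℝ, ∀ v w : V, ‖v - u‖ < r → ‖w‖ < r →
    ‖L₀ (v + w) - L₀ v - linearized L₀ v w‖ ≤ C * ‖w‖ ^ 2

/-- One step of the squared-operator iteration:
`v ↦ v - [M⁻¹ L₁† M⁻¹ L₀ v] Δt`, with `L₁` taken at the current profile `v`. -/
def step (M : V ≃L[ℝ] StrongDual ℝ V) (L₀ : V → StrongDual ℝ V) (Δt : ℝ) (v : V) : V :=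
  v - Δt • M.symm (dagger (linearized L₀ v) (M.symm (L₀ v)))

/-- The iterates `uₙ` of the squared-operator method with initial condition `u₀`. -/
def iterate (M : V ≃L[ℝ] StrongDual ℝ V) (L₀ : V → StrongDual ℝ V) (Δt : ℝ) (u₀ : V) : ℕ → V
  | 0 => u₀
  | n + 1 => step M L₀ Δt (iterate M L₀ Δt u₀ n)

/-- The operator `𝓛 = - M⁻¹ L₁† M⁻¹ L₁`, with `L₁` taken at `u`. -/
def curlyL (M : V ≃L[ℝ] StrongDual ℝ V) (L₀ : V → StrongDual ℝ V) (u : V) : V →L[ℝ] V :=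
  -((M.symm : StrongDual ℝ V →L[ℝ] V).comp ((dagger (linearized L₀ u)).comp
    ((M.symm : StrongDual ℝ V →L[ℝ] V).comp (linearized L₀ u))))

/-- The invariance mode `∂u/∂cⱼ` of a family of profiles, at the parameter `c`. -/
def invarianceMode {s : ℕ} (U : EuclideanSpace ℝ (Fin s) → V) (c : EuclideanSpace ℝ (Fin s))
    (j : Fin s) : V :=
  fderiv ℝ U c (EuclideanSpace.single j 1)

/-- `U` is a continuously differentiable `s`-parameter family of solutions of `L₀ u = 0` near the
parameter `c₀`, and the kernel of `L₁` at the solution `U c₀` consists of nothing but (the linear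
combinations of) the `s` invariance modes. -/
structure KernelAssumption {s : ℕ} (L₀ : V → StrongDual ℝ V)
    (U : EuclideanSpace ℝ (Fin s) → V) (c₀ : EuclideanSpace ℝ (Fin s)) : Prop where
  contDiffAt : ContDiffAt ℝ 1 U c₀
  solution : ∀ᶠ c in 𝓝 c₀, L₀ (U c) = 0
  kernel : ∀ v : V, linearized L₀ (U c₀) v = 0 ↔
    v ∈ Submodule.span ℝ (Set.range (invarianceMode U c₀))

/-- The iteration converges locally to the solitary wave `U c₀`: iterates that start close to it
stay close to it and tend to a solitary wave of the family with slightly shifted parameters (to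
`U c₀` itself if there are no free parameters). -/
def ConvergesNear {s : ℕ} (M : V ≃L[ℝ] StrongDual ℝ V) (L₀ : V → StrongDual ℝ V)
    (U : EuclideanSpace ℝ (Fin s) → V) (c₀ : EuclideanSpace ℝ (Fin s)) (Δt : ℝ) : Prop :=
  ∀ ε > 0, ∃ δ > 0, ∀ u₀ : V, ‖u₀ - U c₀‖ < δ →
    (∀ n, ‖iterate M L₀ Δt u₀ n - U c₀‖ < ε) ∧
    ∃ c, ‖c - c₀‖ < ε ∧ L₀ (U c) = 0 ∧ Tendsto (iterate M L₀ Δt u₀) atTop (𝓝 (U c))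

/-- The iteration diverges from `u`: arbitrarily close to `u` there are initial conditions whose
iterates reach a fixed distance from `u` and from all other solutions of `L₀ v = 0`. -/
def DivergesFrom (M : V ≃L[ℝ] StrongDual ℝ V) (L₀ : V → StrongDual ℝ V) (u : V) (Δt : ℝ) : Prop :=
  ∃ ε > 0, ∀ δ > 0, ∃ u₀ : V, ‖u₀ - u‖ < δ ∧
    ∃ n, ε ≤ ‖iterate M L₀ Δt u₀ n - u‖ ∧
      ∀ v : V, L₀ v = 0 → ε ≤ ‖iterate M L₀ Δt u₀ n - v‖

/-- The iteration diverges from `u` for generic initial conditions: for some neighbourhood of `u`,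
the initial conditions whose iterates all remain in it contain no open set. -/
def DivergesGenericallyFrom (M : V ≃L[ℝ] StrongDual ℝ V) (L₀ : V → StrongDual ℝ V) (u : V)
    (Δt : ℝ) : Prop :=
  ∃ ε > 0, interior {u₀ : V | ∀ n, ‖iterate M L₀ Δt u₀ n - u‖ < ε} = ∅

end SquaredOperator

end

/-! In the inner product `⟨M v, w⟩` the operator `M⁻¹ L₁†` is the adjoint of `M⁻¹ L₁`, so `𝓛 = -B*
B` with `B = M⁻¹ L₁`. Hence `𝓛` is symmetric and non-positive, and its kernel is that of `L₁`. This
inner product induces an equivalent norm because `M` is invertible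
(`IsAcceleration.exists_hilbertSpace`), so everything may be proved in the new Hilbert space and
carried back.

At a solution the step has linearization `A = 1 + Δt 𝓛`, with a remainder quadratic in the distance
to the solution (`exists_norm_step_sub_le`). If `Δt |Λmin| < 2`, the spectrum of `A` lies in `(-1,
1]`; the gap at `0` makes `A` a strict contraction on the orthogonal complement of the kernel. The
kernel directions are tangent to the family of solutions, which are fixed points of the step.
Straightening this family turns it into a linear space of fixed points with transversal contraction,
so the orbit tends to a point of it (`tendsto_iterate_of_fixedPoints`).

If `Δt |Λmin| > 2`, then `-κ = 1 + Δt Λmin < -1` lies in the spectrum of `A` and `κ` bounds the norm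
of `A`. Without a gap at `Λmin` there are only approximate eigenvectors; starting along one that is
accurate enough for a prescribed number of steps, the orbit grows like `κ ^ k`, since no error grows
faster (`exists_iterate_far_from_fixedPoints`). With a gap, `Λmin` is an eigenvalue and `A` expands
its eigenspace more than the complement; an invariant cone around it separates orbits
(`interior_setOf_iterate_near_eq_empty`).

The spectral facts come from one principle: a positive operator bounded below in norm is coercive,
hence invertible. -/

noncomputable section

namespace SquaredOperator

open scoped RealInnerProductSpace

/-! ### Spectrum and quadratic form of symmetric operators. -/

section Spectral

variable {H : Type*} [NormedAddCommGroup H] [InnerProductSpace ℝ H]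

/-- A positive operator `T ≤ p` satisfies `T² ≤ p T`. -/
theorem norm_sq_le_of_inner_le {T : H →L[ℝ] H} (hT : T.IsPositive) {p : ℝ} (hp : 0 < p)
    (h : ∀ x, ⟪T x, x⟫ ≤ p * ‖x‖ ^ 2) (x : H) : ‖T x‖ ^ 2 ≤ p * ⟪T x, x⟫ := by
  -- Positivity at this vector reads `⟪T x, x⟫ - 2 p⁻¹ ‖T x‖² + p⁻² ⟪T (T x), T x⟫ ≥ 0`, and the
  -- last term is at most `p⁻¹ ‖T x‖²`.
  have h1 := hT.inner_nonneg_left (x - p⁻¹ • T x)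
  have h2 := h (T x)
  have h3 : ⟪T (T x), x⟫ = ‖T x‖ ^ 2 := by
    rw [hT.inner_left_eq_inner_right, real_inner_self_eq_norm_sq]
  simp only [map_sub, map_smul, inner_sub_left, inner_sub_right, real_inner_smul_left,
    real_inner_smul_right, real_inner_self_eq_norm_sq, h3] at h1
  have h4 : p⁻¹ * (p⁻¹ * ⟪T (T x), T x⟫) ≤ p⁻¹ * (p⁻¹ * (p * ‖T x‖ ^ 2)) := by gcongr
  have h5 : p⁻¹ * (p⁻¹ * (p * ‖T x‖ ^ 2)) = p⁻¹ * ‖T x‖ ^ 2 := by field_simp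
  have h6 : p⁻¹ * ‖T x‖ ^ 2 ≤ ⟪T x, x⟫ := by linarith
  calc ‖T x‖ ^ 2 = p * (p⁻¹ * ‖T x‖ ^ 2) := by field_simp
    _ ≤ _ := by gcongr

theorem inner_apply_le_norm (T : H →L[ℝ] H) (x : H) : ⟪T x, x⟫ ≤ ‖T‖ * ‖x‖ ^ 2 :=
  calc ⟪T x, x⟫ ≤ ‖T x‖ * ‖x‖ := real_inner_le_norm _ _
    _ ≤ ‖T‖ * ‖x‖ * ‖x‖ := by gcongr; exact T.le_opNorm x
    _ = _ := by ring

/-- A positive operator that is bounded below in norm is coercive. -/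
theorem exists_coercive_of_norm_le {T : H →L[ℝ] H} (hT : T.IsPositive) {c : ℝ} (hc : 0 < c)
    {s : Set H} (h : ∀ x ∈ s, c * ‖x‖ ≤ ‖T x‖) :
    ∃ γ > 0, ∀ x ∈ s, γ * ‖x‖ ^ 2 ≤ ⟪T x, x⟫ := by
  have hp : 0 < ‖T‖ + 1 := by positivity
  refine ⟨c ^ 2 / (‖T‖ + 1), by positivity, fun x hx ↦ ?_⟩
  have h1 := norm_sq_le_of_inner_le hT hp (fun y ↦ (inner_apply_le_norm T y).trans
    (by gcongr; linarith)) x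
  have h2 : (c * ‖x‖) ^ 2 ≤ ‖T x‖ ^ 2 := by gcongr; exact h x hx
  rw [div_mul_eq_mul_div, div_le_iff₀ hp]
  linarith

theorem isUnit_of_coercive [CompleteSpace H] {T : H →L[ℝ] H} {c : ℝ} (hc : 0 < c)
    (h : ∀ x, c * ‖x‖ ^ 2 ≤ ⟪T x, x⟫) : IsUnit T :=
  ContinuousLinearMap.isUnit_of_forall_le_norm_inner_map T (c := ⟨c, hc.le⟩) hc fun x ↦ by
    have := (h x).trans (le_abs_self _)
    change ‖x‖ ^ 2 * c ≤ |⟪T x, x⟫|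
    linarith

theorem exists_norm_le_of_isUnit {T : H →L[ℝ] H} (h : IsUnit T) :
    ∃ c > 0, ∀ x, c * ‖x‖ ≤ ‖T x‖ := by
  obtain ⟨S, hS⟩ := h.exists_left_inv
  refine ⟨(‖S‖ + 1)⁻¹, by positivity, fun x ↦ ?_⟩
  have h1 : S (T x) = x := DFunLike.congr_fun hS x
  rw [inv_mul_le_iff₀ (by positivity)]
  calc ‖x‖ = ‖S (T x)‖ := by rw [h1]
    _ ≤ ‖S‖ * ‖T x‖ := S.le_opNorm _
    _ ≤ _ := by gcongr; linarith

theorem isPositive_of_symm {T : H →L[ℝ] H} (hT : ∀ x y, ⟪T x, y⟫ = ⟪x, T y⟫)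
    (h : ∀ x, 0 ≤ ⟪T x, x⟫) : T.IsPositive :=
  (ContinuousLinearMap.isPositive_iff T).2 ⟨hT, h⟩

/-- A lower bound of the spectrum of a symmetric operator bounds its quadratic form below. -/
theorem le_inner_of_forall_notMem_spectrum [CompleteSpace H] {T : H →L[ℝ] H}
    (hT : ∀ x y, ⟪T x, y⟫ = ⟪x, T y⟫) {μ : ℝ} (h : ∀ l < μ, l ∉ spectrum ℝ T) (x : H) :
    μ * ‖x‖ ^ 2 ≤ ⟪T x, x⟫ := by
  by_contra! hx
  have hx0 : 0 < ‖x‖ := by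
    rcases (norm_nonneg x).eq_or_lt with h0 | h0
    · rw [norm_eq_zero.1 h0.symm] at hx; simp at hx
    · exact h0
  -- The best lower bound `m` of the form is attained in `S`. Were it below `μ`, `T - m` would be
  -- positive and invertible, hence coercive, and `m` could be increased.
  set S : Set ℝ := {m | ∀ y, m * ‖y‖ ^ 2 ≤ ⟪T y, y⟫} with hS
  have hne : S.Nonempty := by
    refine ⟨-‖T‖, fun y ↦ ?_⟩
    have := inner_apply_le_norm (-T) y
    simp only [norm_neg, neg_apply, inner_neg_left] at this
    linarith
  have hub : ∀ m ∈ S, m ≤ ⟪T x, x⟫ / ‖x‖ ^ 2 := fun m hm ↦ by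
    rw [le_div_iff₀ (by positivity)]; exact hm x
  have hbdd : BddAbove S := ⟨_, hub⟩
  have hcl : IsClosed S := by
    simp only [hS, Set.ofPred_forall]
    exact isClosed_iInter fun y ↦ isClosed_le (by fun_prop) continuous_const
  have hm : sSup S ∈ S := hcl.csSup_mem hne hbdd
  set m := sSup S
  have hmμ : m < μ := by
    refine (hub m hm).trans_lt ?_
    rwa [div_lt_iff₀ (by positivity)]
  have hu : IsUnit (T - algebraMap ℝ (H →L[ℝ] H) m) := by
    have := spectrum.notMem_iff.1 (h m hmμ)
    rw [← neg_sub]; exact this.neg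
  have hform : ∀ y z, ⟪(T - algebraMap ℝ (H →L[ℝ] H) m) y, z⟫ = ⟪T y, z⟫ - m * ⟪y, z⟫ := by
    intro y z
    simp [Algebra.algebraMap_eq_smul_one, inner_sub_left, real_inner_smul_left]
  have hpos : (T - algebraMap ℝ (H →L[ℝ] H) m).IsPositive := by
    refine isPositive_of_symm (fun y z ↦ ?_) (fun y ↦ ?_)
    · rw [hform, ← real_inner_comm y ((T - _) z), hform, hT y z, real_inner_comm y z,
        real_inner_comm y (T z)]
    · rw [hform, real_inner_self_eq_norm_sq]; linarith [hm y]
  obtain ⟨c, hc, hcT⟩ := exists_norm_le_of_isUnit hu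
  obtain ⟨γ, hγ, hγT⟩ := exists_coercive_of_norm_le hpos hc (s := Set.univ) fun y _ ↦ hcT y
  have : m + γ ∈ S := fun y ↦ by
    have := hγT y trivial
    rw [hform, real_inner_self_eq_norm_sq] at this
    linarith
  linarith [le_csSup hbdd this]

/-- If `0` is isolated in the spectrum of a positive operator, the operator is coercive on the
orthogonal complement of its kernel. -/
theorem exists_coercive_orthogonal_ker [CompleteSpace H] {P : H →L[ℝ] H} (hP : P.IsPositive)
    {γ : ℝ} (hγ : 0 < γ) (h : ∀ l ∈ spectrum ℝ P, l ≠ 0 → γ ≤ l) :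
    ∃ γ' > 0, ∀ x ∈ (P.ker)ᗮ, γ' * ‖x‖ ^ 2 ≤ ⟪P x, x⟫ := by
  have hsymm : ∀ x y, ⟪P x, y⟫ = ⟪x, P y⟫ := hP.inner_left_eq_inner_right
  have hgap : ∀ l, l ≠ 0 → l < γ → IsUnit (P - algebraMap ℝ _ l) := fun l hl hlγ ↦ by
    rw [← neg_sub]
    refine (spectrum.notMem_iff.1 fun hmem ↦ ?_).neg
    linarith [h l hmem hl]
  -- The spectrum of `P²` avoids `(0, γ²)`, an interval centred at `a` with radius `a`. So `R = P² -
  -- a` should satisfy `R² ≥ a²`, which expands to `‖P (P x)‖ ≥ γ ‖P x‖`: a lower bound of `P` on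
  -- its range, whose closure is the orthogonal complement of the kernel.
  set a : ℝ := γ ^ 2 / 2 with ha
  have ha0 : 0 < a := by positivity
  have hquad : ∀ b, 0 < b → b < γ ^ 2 → IsUnit (P * P - algebraMap ℝ _ b) := fun b hb hbγ ↦ by
    have hsq : Real.sqrt b * Real.sqrt b = b := Real.mul_self_sqrt hb.le
    have h1 := hgap (Real.sqrt b) (Real.sqrt_pos.2 hb).ne' ((Real.sqrt_lt' hγ).2 hbγ)
    have h2 := hgap (-Real.sqrt b) (by simpa using (Real.sqrt_pos.2 hb).ne')
      (by linarith [Real.sqrt_nonneg b])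
    have h3 := h1.mul h2
    have h4 : (P - algebraMap ℝ _ (Real.sqrt b)) * (P - algebraMap ℝ _ (-Real.sqrt b))
        = P * P - algebraMap ℝ _ b := by
      nth_rw 3 [← hsq]
      rw [map_neg, map_mul, sub_neg_eq_add, sub_mul, mul_add, mul_add,
        ← Algebra.commutes (Real.sqrt b) P]
      abel
    rwa [h4] at h3
  set R : H →L[ℝ] H := P * P - algebraMap ℝ _ a with hR
  have hRsymm : ∀ x y, ⟪R x, y⟫ = ⟪x, R y⟫ := fun x y ↦ by
    simp [hR, Algebra.algebraMap_eq_smul_one, inner_sub_left, inner_sub_right,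
      real_inner_smul_left, real_inner_smul_right, hsymm]
  have hRR : ∀ x y, ⟪(R * R) x, y⟫ = ⟪x, (R * R) y⟫ := fun x y ↦ by
    simp only [mul_apply_eq_comp, hRsymm]
  have hspec : ∀ l < a ^ 2, l ∉ spectrum ℝ (R * R) := by
    intro l hl
    rw [spectrum.notMem_iff, ← neg_sub, IsUnit.neg_iff]
    rcases lt_or_ge l 0 with hl0 | hl0
    · refine isUnit_of_coercive (c := -l) (by linarith) fun x ↦ ?_
      have : ⟪(R * R) x, x⟫ = ‖R x‖ ^ 2 := by
        rw [mul_apply_eq_comp, hRsymm, real_inner_self_eq_norm_sq]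
      simp only [sub_apply, inner_sub_left, this, Algebra.algebraMap_eq_smul_one,
        smul_apply, one_apply_eq_self, real_inner_smul_left,
        real_inner_self_eq_norm_sq]
      nlinarith [sq_nonneg ‖R x‖]
    -- Here `R² - l = (P² - (a + √l)) (P² - (a - √l))`, and both shifts lie in `(0, γ²)`.
    · have hsq : Real.sqrt l * Real.sqrt l = l := Real.mul_self_sqrt hl0
      have hlt : Real.sqrt l < a := (Real.sqrt_lt' ha0).2 hl
      have hnn := Real.sqrt_nonneg l
      have h1 := hquad (a + Real.sqrt l) (by linarith) (by linarith)
      have h2 := hquad (a - Real.sqrt l) (by linarith) (by linarith)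
      have h3 := h1.mul h2
      have h4 : (P * P - algebraMap ℝ (H →L[ℝ] H) (a + Real.sqrt l)) *
          (P * P - algebraMap ℝ _ (a - Real.sqrt l)) = R * R - algebraMap ℝ _ l := by
        have e1 : P * P - algebraMap ℝ (H →L[ℝ] H) (a + Real.sqrt l)
            = R - algebraMap ℝ _ (Real.sqrt l) := by rw [hR, map_add]; abel
        have e2 : P * P - algebraMap ℝ (H →L[ℝ] H) (a - Real.sqrt l)
            = R + algebraMap ℝ _ (Real.sqrt l) := by rw [hR, map_sub]; abel
        rw [e1, e2, sub_mul, mul_add, mul_add, ← Algebra.commutes (Real.sqrt l) R, ← map_mul, hsq]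
        abel
      rwa [h4] at h3
  have hkey : ∀ x, γ * ‖P x‖ ≤ ‖P (P x)‖ := fun x ↦ by
    have h1 := le_inner_of_forall_notMem_spectrum hRR hspec x
    have h2 : ⟪(R * R) x, x⟫ = ‖P (P x)‖ ^ 2 - γ ^ 2 * ‖P x‖ ^ 2 + a ^ 2 * ‖x‖ ^ 2 := by
      rw [mul_apply_eq_comp, hRsymm]
      have h3 : ⟪P (P x), x⟫ = ‖P x‖ ^ 2 := by rw [hsymm, real_inner_self_eq_norm_sq]
      have h3' : ⟪x, P (P x)⟫ = ‖P x‖ ^ 2 := by rw [real_inner_comm, h3]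
      simp only [hR, sub_apply, mul_apply_eq_comp, Algebra.algebraMap_eq_smul_one,
        smul_apply, one_apply_eq_self, inner_sub_left, inner_sub_right,
        real_inner_smul_left, real_inner_smul_right, real_inner_self_eq_norm_sq, h3, h3']
      rw [norm_smul, mul_pow, Real.norm_eq_abs, sq_abs, ha]; ring
    have h5 : (γ * ‖P x‖) ^ 2 ≤ ‖P (P x)‖ ^ 2 := by rw [h2] at h1; linarith
    exact le_of_sq_le_sq h5 (norm_nonneg _)
  refine exists_coercive_of_norm_le hP hγ (s := (P.ker)ᗮ) fun x hx ↦ ?_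
  have hadj : ContinuousLinearMap.adjoint P = P := hP.isSelfAdjoint.adjoint_eq
  rw [ContinuousLinearMap.orthogonal_ker, hadj] at hx
  have hcl : IsClosed {y : H | γ * ‖y‖ ≤ ‖P y‖} := isClosed_le (by fun_prop) (by fun_prop)
  refine hcl.closure_subset_iff.2 ?_ (show x ∈ closure (P.range : Set H) from hx)
  rintro _ ⟨y, rfl⟩
  exact hkey y

/-- A positive operator with `0` in its spectrum has approximate null vectors. -/
theorem exists_unit_norm_le_of_zero_mem_spectrum [CompleteSpace H] {P : H →L[ℝ] H}
    (hP : P.IsPositive) (h0 : (0 : ℝ) ∈ spectrum ℝ P) {ε : ℝ} (hε : 0 < ε) :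
    ∃ v, ‖v‖ = 1 ∧ ‖P v‖ ≤ ε := by
  by_contra! hcon
  have h1 : ∀ x, ε * ‖x‖ ≤ ‖P x‖ := fun x ↦ by
    rcases eq_or_ne x 0 with rfl | hx
    · simp
    have hx' : 0 < ‖x‖ := norm_pos_iff.2 hx
    have h2 := hcon (‖x‖⁻¹ • x) (by rw [norm_smul, norm_inv, norm_norm, inv_mul_cancel₀ hx'.ne'])
    rw [map_smul, norm_smul, norm_inv, norm_norm, lt_inv_mul_iff₀ hx'] at h2
    linarith
  obtain ⟨γ, hγ, hγP⟩ := exists_coercive_of_norm_le hP hε (s := Set.univ) fun x _ ↦ h1 x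
  refine spectrum.mem_iff.1 h0 ?_
  rw [map_zero, zero_sub, IsUnit.neg_iff]
  exact isUnit_of_coercive hγ fun x ↦ hγP x trivial

/-- If `0` is isolated in the spectrum of a positive operator, it is an eigenvalue. -/
theorem exists_ker_ne_zero [CompleteSpace H] {P : H →L[ℝ] H} (hP : P.IsPositive)
    (h0 : (0 : ℝ) ∈ spectrum ℝ P) {γ : ℝ} (hγ : 0 < γ)
    (h : ∀ l ∈ spectrum ℝ P, l ≠ 0 → γ ≤ l) : ∃ v, v ≠ 0 ∧ P v = 0 := by
  by_contra! hcon
  obtain ⟨γ', hγ', hP'⟩ := exists_coercive_orthogonal_ker hP hγ h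
  have hker : P.ker = ⊥ := (LinearMap.ker_eq_bot').2 fun v hv ↦ by
    by_contra hne
    exact hcon v hne hv
  refine spectrum.mem_iff.1 h0 ?_
  rw [map_zero, zero_sub, IsUnit.neg_iff]
  exact isUnit_of_coercive hγ' fun x ↦ hP' x (by rw [hker]; simp)

end Spectral

/-! ### Local dynamics near a fixed point. -/

section Dynamics

variable {E : Type*} [NormedAddCommGroup E] [NormedSpace ℝ E]

theorem exists_ball_norm_sub_le {F : E → E} {A : E →L[ℝ] E} {a : E} (hF : HasStrictFDerivAt F A a)
    {η : ℝ} (hη : 0 < η) : ∃ r > 0, ∀ x y, ‖x - a‖ < r → ‖y - a‖ < r →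
      ‖F x - F y - A (x - y)‖ ≤ η * ‖x - y‖ := by
  have h := hF.isLittleO.def hη
  obtain ⟨r, hr, hball⟩ := Metric.eventually_nhds_iff.1 h
  refine ⟨r, hr, fun x y hx hy ↦ hball (y := (x, y)) ?_⟩
  simpa [Prod.dist_eq, dist_eq_norm] using And.intro hx hy

/-- A map with a linear subspace of fixed points, the range of the projection `p`, whose
linearization contracts transversally, converges near `0` to fixed points. -/
theorem tendsto_iterate_of_linear_fixedPoints [CompleteSpace E] {G : E → E} {A p : E →L[ℝ] E}
    {ρ : ℝ} (hG : HasStrictFDerivAt G A 0) (hfix : ∀ᶠ x in 𝓝 (0 : E), p x = x → G x = x)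
    (hpp : ∀ x, p (p x) = p x) (hpA : ∀ x, p (A x) = p x) (hρ0 : 0 ≤ ρ) (hρ : ρ < 1)
    (hA : ∀ x, ‖A (x - p x)‖ ≤ ρ * ‖x - p x‖) {ε : ℝ} (hε : 0 < ε) :
    ∃ δ > 0, ∀ x, ‖x‖ < δ → (∀ n, ‖G^[n] x‖ < ε) ∧
      ∃ y, p y = y ∧ ‖y‖ ≤ ε ∧ Tendsto (fun n ↦ G^[n] x) atTop (𝓝 y) := by
  set K : ℝ := 1 + ‖p‖ with hK
  have hK1 : 1 ≤ K := by rw [hK]; linarith [norm_nonneg p]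
  have hpK : ∀ x, ‖p x‖ ≤ K * ‖x‖ := fun x ↦ (p.le_opNorm x).trans (by gcongr; linarith)
  have hqK : ∀ x, ‖x - p x‖ ≤ K * ‖x‖ := fun x ↦ by
    have h1 := norm_sub_le x (p x)
    have h2 := p.le_opNorm x
    rw [hK]; linarith
  set ρ' : ℝ := (1 + ρ) / 2 with hρ'
  have hρ'1 : ρ' < 1 := by rw [hρ']; linarith
  have hρ'0 : 0 < ρ' := by rw [hρ']; linarith
  -- Chosen so that `ρ + K η = ρ'`: the nonlinear error uses up half of the contraction margin.
  set η : ℝ := (1 - ρ) / (2 * K) with hη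
  have hη0 : 0 < η := div_pos (by linarith) (by linarith)
  have hKη : K * η = (1 - ρ) / 2 := by rw [hη]; field_simp
  obtain ⟨r₁, hr₁, hG₁⟩ := exists_ball_norm_sub_le hG hη0
  obtain ⟨r₂, hr₂, hfix₂⟩ := Metric.eventually_nhds_iff.1 hfix
  set r : ℝ := min r₁ r₂ / K with hr
  have hr0 : 0 < r := by positivity
  have hstep : ∀ x, ‖x‖ < r → ‖G x - p (G x)‖ ≤ ρ' * ‖x - p x‖ ∧
      ‖p (G x) - p x‖ ≤ ‖x - p x‖ := by
    intro x hx
    have hKx : K * ‖x‖ < min r₁ r₂ := by rw [mul_comm]; exact (lt_div_iff₀ (by linarith)).1 hx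
    have hx1 : ‖x‖ < r₁ := by nlinarith [norm_nonneg x, min_le_left r₁ r₂]
    have hpx1 : ‖p x‖ < r₁ := by linarith [hpK x, min_le_left r₁ r₂]
    have hpx2 : ‖p x‖ < r₂ := by linarith [hpK x, min_le_right r₁ r₂]
    -- Comparing `x` with the fixed point `p x`, rather than with `0`, makes the error proportional
    -- to the distance `‖x - p x‖`. The drift along the fixed space is therefore summable.
    have hGp : G (p x) = p x := hfix₂ (by simpa using hpx2) (hpp x)
    have hE := hG₁ x (p x) (by simpa using hx1) (by simpa using hpx1)
    rw [hGp] at hE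
    set e := G x - p x - A (x - p x) with he
    have hGx : G x = p x + A (x - p x) + e := by rw [he]; abel
    have hpe : p (G x) = p x + p e := by
      rw [hGx, map_add, map_add, hpp, hpA, map_sub, hpp]; abel
    constructor
    · have : G x - p (G x) = A (x - p x) + (e - p e) := by rw [hpe, hGx]; abel
      calc ‖G x - p (G x)‖ ≤ ‖A (x - p x)‖ + ‖e - p e‖ := by rw [this]; exact norm_add_le _ _
        _ ≤ ρ * ‖x - p x‖ + K * (η * ‖x - p x‖) := by
          gcongr
          · exact hA x
          · exact (hqK e).trans (by gcongr)
        _ = ρ' * ‖x - p x‖ := by rw [← mul_assoc, hKη, hρ']; ring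
    · calc ‖p (G x) - p x‖ = ‖p e‖ := by rw [hpe, add_sub_cancel_left]
        _ ≤ K * (η * ‖x - p x‖) := (hpK e).trans (by gcongr)
        _ = (1 - ρ) / 2 * ‖x - p x‖ := by rw [← mul_assoc, hKη]
        _ ≤ 1 * ‖x - p x‖ := by gcongr; linarith
        _ = _ := one_mul _
  set R : ℝ := min ε r with hR
  have hR0 : 0 < R := lt_min hε hr0
  -- One unit for `‖p x‖`, one for the transversal part, and the geometric sum for the total drift.
  set B : ℝ := 2 + 1 / (1 - ρ') with hB
  have h1ρ' : 0 < 1 - ρ' := by linarith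
  have hB0 : 0 < B := by positivity
  refine ⟨R / (K * B), by positivity, fun x hx ↦ ?_⟩
  set d := ‖x - p x‖ with hd
  have hd0 : 0 ≤ d := norm_nonneg _
  have hxB : K * ‖x‖ * B < R := by
    rw [lt_div_iff₀ (by positivity)] at hx; linarith
  have hball : ∀ y, ‖y - p y‖ ≤ d → ‖p y - p x‖ ≤ d * (1 / (1 - ρ')) → ‖y‖ < R := by
    intro y h1 h2
    have h3 : ‖y‖ ≤ ‖y - p y‖ + ‖p y - p x‖ + ‖p x‖ := by
      calc ‖y‖ = ‖(y - p y) + (p y - p x) + p x‖ := by congr 1; abel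
        _ ≤ _ := norm_add₃_le
    have h4 : d * (1 / (1 - ρ')) ≤ K * ‖x‖ * (1 / (1 - ρ')) := by gcongr; exact hqK x
    have h5 := hpK x
    have h6 : d ≤ K * ‖x‖ := hqK x
    rw [hB] at hxB
    linarith
  have hind : ∀ n, ‖G^[n] x - p (G^[n] x)‖ ≤ ρ' ^ n * d ∧
      ‖p (G^[n] x) - p x‖ ≤ d * ((1 - ρ' ^ n) / (1 - ρ')) ∧ ‖G^[n] x‖ < R := by
    intro n
    induction n with
    | zero =>
      refine ⟨by simp [hd], by simp, hball _ (by simp [hd]) ?_⟩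
      simp only [Function.iterate_zero, id_eq, sub_self, norm_zero]; positivity
    | succ n ih =>
      obtain ⟨h1, h2, h3⟩ := ih
      obtain ⟨h4, h5⟩ := hstep _ (h3.trans_le (min_le_right _ _))
      rw [Function.iterate_succ_apply']
      have hpow : ρ' ^ (n + 1) ≤ 1 := pow_le_one₀ hρ'0.le hρ'1.le
      have h6 : ‖G (G^[n] x) - p (G (G^[n] x))‖ ≤ ρ' ^ (n + 1) * d := by
        refine h4.trans ?_
        calc _ ≤ ρ' * (ρ' ^ n * d) := by gcongr
          _ = _ := by ring
      have h7 : ‖p (G (G^[n] x)) - p x‖ ≤ d * ((1 - ρ' ^ (n + 1)) / (1 - ρ')) := by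
        calc _ = ‖(p (G (G^[n] x)) - p (G^[n] x)) + (p (G^[n] x) - p x)‖ := by congr 1; abel
          _ ≤ ρ' ^ n * d + d * ((1 - ρ' ^ n) / (1 - ρ')) :=
            (norm_add_le _ _).trans (add_le_add (h5.trans h1) h2)
          _ = _ := by field_simp; ring
      refine ⟨h6, h7, hball _ (h6.trans (mul_le_of_le_one_left hd0 hpow)) (h7.trans ?_)⟩
      gcongr
      linarith [pow_pos hρ'0 (n + 1)]
  have hcauchy : CauchySeq fun n ↦ p (G^[n] x) := by
    refine cauchySeq_of_le_geometric ρ' d hρ'1 fun n ↦ ?_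
    rw [dist_comm, dist_eq_norm, Function.iterate_succ_apply']
    have := (hstep _ ((hind n).2.2.trans_le (min_le_right _ _))).2.trans (hind n).1
    linarith
  obtain ⟨y, hy⟩ := cauchySeq_tendsto_of_complete hcauchy
  have hq : Tendsto (fun n ↦ G^[n] x - p (G^[n] x)) atTop (𝓝 0) := by
    refine squeeze_zero_norm (fun n ↦ (hind n).1) ?_
    simpa using (tendsto_pow_atTop_nhds_zero_of_lt_one hρ'0.le hρ'1).mul_const d
  have hlim : Tendsto (fun n ↦ G^[n] x) atTop (𝓝 y) := by
    simpa using hq.add hy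
  refine ⟨fun n ↦ (hind n).2.2.trans_le (min_le_left _ _), y, ?_, ?_, hlim⟩
  · refine tendsto_nhds_unique ((p.continuous.tendsto y).comp hy) ?_
    simpa only [Function.comp_def, hpp] using hy
  · exact le_of_tendsto hlim.norm
      (Eventually.of_forall fun n ↦ ((hind n).2.2.trans_le (min_le_left _ _)).le)

/-- The same for a family of fixed points `W (p x)`, tangent to the range of `p`. -/
theorem tendsto_iterate_of_fixedPoints [CompleteSpace E] {F W : E → E} {A p : E →L[ℝ] E} {u : E}
    {ρ : ℝ} (hF : HasStrictFDerivAt F A u) (hW : HasStrictFDerivAt W p 0) (hW0 : W 0 = u)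
    (hfix : ∀ᶠ x in 𝓝 (0 : E), F (W x) = W x)
    (hpp : ∀ x, p (p x) = p x) (hpA : ∀ x, p (A x) = p x) (hρ0 : 0 ≤ ρ) (hρ : ρ < 1)
    (hA : ∀ x, ‖A (x - p x)‖ ≤ ρ * ‖x - p x‖) {ε : ℝ} (hε : 0 < ε) :
    ∃ δ > 0, ∀ x, ‖x - u‖ < δ → (∀ n, ‖F^[n] x - u‖ < ε) ∧
      ∃ y, ‖y‖ < ε ∧ Tendsto (fun n ↦ F^[n] x) atTop (𝓝 (W y)) := by
  -- A straightening chart: its derivative at `0` is `p + (1 - p) = 1`, and it agrees with `W` on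
  -- the range of `p`. The conjugate of `F` by it thus has linear fixed points and the same
  -- linearization `A`.
  set Φ : E → E := fun x ↦ W x + (x - p x) with hΦ
  have hΦ' : HasStrictFDerivAt Φ ((ContinuousLinearEquiv.refl ℝ E : E ≃L[ℝ] E) : E →L[ℝ] E) 0 := by
    have h := hW.add ((hasStrictFDerivAt_id (𝕜 := ℝ) (0 : E)).sub p.hasStrictFDerivAt)
    have h' : ((ContinuousLinearEquiv.refl ℝ E : E ≃L[ℝ] E) : E →L[ℝ] E)
        = p + (ContinuousLinearMap.id ℝ E - p) := by ext x; simp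
    rw [h']
    exact h
  have hΦ0 : Φ 0 = u := by simp [hΦ, hW0]
  set Ψ := hΦ'.localInverse Φ _ 0 with hΨ
  have hΨ' : HasStrictFDerivAt Ψ ((ContinuousLinearEquiv.refl ℝ E : E ≃L[ℝ] E) : E →L[ℝ] E) u := by
    have := hΦ'.to_localInverse
    rwa [hΦ0] at this
  have hΨ0 : Ψ u = 0 := by rw [← hΦ0]; exact hΦ'.localInverse_apply_image
  have hleft : ∀ᶠ x in 𝓝 (0 : E), Ψ (Φ x) = x := hΦ'.eventually_left_inverse
  have hright : ∀ᶠ x in 𝓝 u, Φ (Ψ x) = x := by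
    have := hΦ'.eventually_right_inverse
    rwa [hΦ0] at this
  have hFu : F u = u := by simpa [hW0] using hfix.self_of_nhds
  set G : E → E := fun x ↦ Ψ (F (Φ x)) with hG
  have hG' : HasStrictFDerivAt G A 0 := by
    have h1 : HasStrictFDerivAt F A (Φ 0) := by rwa [hΦ0]
    have h2 := h1.comp 0 hΦ'
    have h3 : HasStrictFDerivAt Ψ ((ContinuousLinearEquiv.refl ℝ E : E ≃L[ℝ] E) : E →L[ℝ] E)
        ((F ∘ Φ) 0) := by
      rw [Function.comp_apply, hΦ0, hFu]; exact hΨ'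
    exact h3.comp 0 h2
  have hGfix : ∀ᶠ x in 𝓝 (0 : E), p x = x → G x = x := by
    filter_upwards [hfix, hleft] with x hx1 hx2 hpx
    have : Φ x = W x := by simp [hΦ, hpx]
    rw [hG]
    simp only
    rw [this, hx1, ← this, hx2]
  have hconj : ∀ᶠ x in 𝓝 (0 : E), Φ (G x) = F (Φ x) := by
    have hcont : Tendsto (fun x ↦ F (Φ x)) (𝓝 0) (𝓝 u) := by
      have h1 : Tendsto Φ (𝓝 0) (𝓝 u) := by simpa [hΦ0] using hΦ'.continuousAt.tendsto
      have h2 : Tendsto F (𝓝 u) (𝓝 u) := by simpa [hFu] using hF.continuousAt.tendsto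
      exact h2.comp h1
    exact hcont.eventually hright
  have hΦc : Tendsto Φ (𝓝 0) (𝓝 u) := by simpa [hΦ0] using hΦ'.continuousAt.tendsto
  have hΦε : ∀ᶠ x in 𝓝 (0 : E), ‖Φ x - u‖ < ε := by
    have := hΦc.eventually (Metric.ball_mem_nhds u hε)
    simpa [dist_eq_norm] using this
  -- The limit is taken at a point `y` that need not be `0`, so continuity is needed on a
  -- neighbourhood.
  have hΦcont : ∀ᶠ x in 𝓝 (0 : E), ContinuousAt Φ x := by
    obtain ⟨s, hs, hsΦ⟩ := hΦ'.approximates_deriv_on_nhds (c := 1) (Or.inr one_pos)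
    filter_upwards [eventually_mem_nhds_iff.2 hs] with x hx
    exact hsΦ.continuousOn.continuousAt hx
  obtain ⟨r, hr, hball⟩ := Metric.eventually_nhds_iff.1 (hconj.and (hΦε.and hΦcont))
  simp only [dist_zero_right] at hball
  set ε' := min (ε / 2) (r / 2) with hε'
  have hε'0 : 0 < ε' := by positivity
  obtain ⟨δ, hδ, hGδ⟩ := tendsto_iterate_of_linear_fixedPoints hG' hGfix hpp hpA hρ0 hρ hA hε'0
  have hΨc : Tendsto Ψ (𝓝 u) (𝓝 0) := by simpa [hΨ0] using hΨ'.continuousAt.tendsto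
  have hΨδ : ∀ᶠ x in 𝓝 u, ‖Ψ x‖ < δ := by
    have := hΨc.eventually (Metric.ball_mem_nhds 0 hδ)
    simpa [dist_eq_norm] using this
  obtain ⟨δ', hδ', hball'⟩ := Metric.eventually_nhds_iff.1 (hΨδ.and hright)
  refine ⟨δ', hδ', fun x hx ↦ ?_⟩
  obtain ⟨h1, h2⟩ := hball' (by rwa [dist_eq_norm])
  obtain ⟨h3, y, hy1, hy2, hy3⟩ := hGδ _ h1
  have hlt : ε' < r := (min_le_right _ _).trans_lt (by linarith)
  have hiter : ∀ n, F^[n] x = Φ (G^[n] (Ψ x)) := by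
    intro n
    induction n with
    | zero => simp [h2]
    | succ n ih =>
      rw [Function.iterate_succ_apply', ih, Function.iterate_succ_apply',
        (hball ((h3 n).trans hlt)).1]
  refine ⟨fun n ↦ ?_, y, ?_, ?_⟩
  · rw [hiter]; exact (hball ((h3 n).trans hlt)).2.1
  · exact hy2.trans_lt ((min_le_left _ _).trans_lt (by linarith))
  · have hy4 : Φ y = W y := by simp [hΦ, hy1]
    simp only [hiter]
    rw [← hy4]
    exact (hball (hy2.trans_lt hlt)).2.2.tendsto.comp hy3

/-- A fixed point whose linearization has the approximate eigenvalue `-κ`, `κ > 1` being its norm,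
is unstable, and the iterates leave the set of fixed points. -/
theorem exists_iterate_far_from_fixedPoints {F : E → E} {A : E →L[ℝ] E} {u : E} {κ r C : ℝ}
    (hκ : 1 < κ) (hA : ∀ x, ‖A x‖ ≤ κ * ‖x‖)
    (happrox : ∀ ε > 0, ∃ v, ‖v‖ = 1 ∧ ‖A v + κ • v‖ ≤ ε) (hr : 0 < r) (hC : 0 < C)
    (hF : ∀ x, ‖x - u‖ < r → ‖F x - u - A (x - u)‖ ≤ C * ‖x - u‖ ^ 2) :
    ∃ ε > 0, ∀ δ > 0, ∃ x, ‖x - u‖ < δ ∧ ∃ n, ε ≤ ‖F^[n] x - u‖ ∧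
      ∀ y, F y = y → ε ≤ ‖F^[n] x - y‖ := by
  have hκ0 : 0 < κ := by linarith
  -- With this value `D (κ a)² = κ D a² + 4 C a²`, so the bound `D a²` for the accumulated quadratic
  -- errors reproduces itself when the amplitude `a` becomes `κ a`.
  set D : ℝ := 4 * C / (κ * (κ - 1)) with hD
  have hD0 : 0 < D := div_pos (by linarith) (mul_pos hκ0 (by linarith))
  have hDκ : D * (κ * (κ - 1)) = 4 * C := by
    rw [hD]; exact div_mul_cancel₀ _ (mul_pos hκ0 (by linarith)).ne'
  set ε₀ : ℝ := min (r / 4) (min (1 / (8 * D)) (1 / (16 * C))) with hε₀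
  have hε₀0 : 0 < ε₀ := by positivity
  have hε₀r : ε₀ ≤ r / 4 := min_le_left _ _
  have hε₀D : D * ε₀ ≤ 1 / 8 := by
    have : ε₀ ≤ 1 / (8 * D) := (min_le_right _ _).trans (min_le_left _ _)
    rw [le_div_iff₀ (by positivity)] at this; linarith
  have hε₀C : C * ε₀ ≤ 1 / 16 := by
    have : ε₀ ≤ 1 / (16 * C) := (min_le_right _ _).trans (min_le_right _ _)
    rw [le_div_iff₀ (by positivity)] at this; linarith
  refine ⟨ε₀ / 4, by positivity, fun δ hδ ↦ ?_⟩
  -- The number of steps is fixed first, so that amplitude `ε₀ / κ ^ n < δ` grows to `ε₀`; the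
  -- approximate eigenvector is then taken accurate enough for `n` steps.
  obtain ⟨n, hn⟩ := pow_unbounded_of_one_lt (ε₀ / δ) hκ
  have hκn : 0 < κ ^ n := by positivity
  have hδn : ε₀ / κ ^ n < δ := by
    rw [div_lt_iff₀ hδ] at hn; rw [div_lt_iff₀ hκn]; linarith
  set μ : ℝ := 1 / (8 * (n + 1)) with hμ
  have hμ0 : 0 < μ := by positivity
  have hnμ : (n + 1) * μ = 1 / 8 := by rw [hμ]; field_simp
  obtain ⟨v, hv1, hvA⟩ := happrox μ hμ0
  set a : ℕ → ℝ := fun k ↦ ε₀ / κ ^ n * κ ^ k with ha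
  have ha0 : ∀ k, 0 < a k := fun k ↦ by positivity
  have ha_succ : ∀ k, a (k + 1) = κ * a k := fun k ↦ by simp only [ha]; ring
  have han : a n = ε₀ := by simp only [ha]; field_simp
  have hale : ∀ k ≤ n, a k ≤ ε₀ := fun k hk ↦ by
    rw [← han]; simp only [ha]; gcongr; exact hκ.le
  set x := u + (ε₀ / κ ^ n) • v with hx
  set z : ℕ → E := fun k ↦ ((-1) ^ k * a k) • v with hz
  have hz_norm : ∀ k, ‖z k‖ = a k := fun k ↦ by
    simp [hz, norm_smul, hv1, abs_of_pos (ha0 k)]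
  have hkμ : ∀ k ≤ n, (k : ℝ) * μ ≤ 1 / 8 := fun k hk ↦ by
    rw [← hnμ]; gcongr
    have : (k : ℝ) ≤ n := by exact_mod_cast hk
    linarith
  have hquarter : ∀ k ≤ n, a k * (k * μ + D * a k) ≤ a k / 4 := fun k hk ↦ by
    have h1 := hkμ k hk
    have h2 : D * a k ≤ D * ε₀ := by gcongr; exact hale k hk
    have h3 : a k * (k * μ + D * a k) ≤ a k * (1 / 4) := by
      have := (ha0 k).le
      gcongr; linarith
    linarith
  -- The model orbit `z` follows the eigenvalue `-κ` exactly. The relative error is `μ` per step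
  -- from the eigenvector defect, plus `D a k` from the nonlinearity; as `κ` bounds the norm of `A`,
  -- old errors never outgrow `a k`.
  have hind : ∀ k ≤ n, ‖F^[k] x - u - z k‖ ≤ a k * (k * μ + D * a k) := by
    intro k
    induction k with
    | zero =>
      intro _
      have h1 : F^[0] x - u - z 0 = 0 := by simp [hx, hz, ha]
      rw [h1, norm_zero]
      have := ha0 0
      positivity
    | succ k ih =>
      intro hk
      have hk' : k ≤ n := by omega
      have h1 := ih hk'
      set w := F^[k] x - u with hw
      have h2 : ‖w‖ ≤ 2 * a k := by
        have := norm_le_norm_add_norm_sub' w (z k)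
        rw [hz_norm] at this
        linarith [hquarter k hk', ha0 k]
      have h3 : ‖w‖ < r := by linarith [hale k hk']
      have h4 := hF _ h3
      rw [← Function.iterate_succ_apply' F] at h4
      have h5 : F^[k + 1] x - u - z (k + 1) = (F^[k + 1] x - u - A w) + A (w - z k)
          + ((-1) ^ k * a k) • (A v + κ • v) := by
        simp only [hz, ha_succ, map_sub, map_smul]
        rw [pow_succ]
        module
      have h6 : ‖((-1) ^ k * a k) • (A v + κ • v)‖ ≤ a k * μ := by
        rw [norm_smul]
        simp only [norm_mul, norm_pow, norm_neg, norm_one, one_pow, one_mul, Real.norm_eq_abs,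
          abs_of_pos (ha0 k)]
        have := (ha0 k).le
        gcongr
      have h7 : ‖A (w - z k)‖ ≤ κ * (a k * (k * μ + D * a k)) := (hA _).trans (by gcongr)
      have h8 : C * ‖w‖ ^ 2 ≤ C * (2 * a k) ^ 2 := by gcongr
      have h9 : a k * μ ≤ κ * (a k * μ) := by
        have := mul_pos (ha0 k) hμ0
        nlinarith
      calc ‖F^[k + 1] x - u - z (k + 1)‖
          ≤ C * (2 * a k) ^ 2 + κ * (a k * (k * μ + D * a k)) + κ * (a k * μ) := by
            rw [h5]
            exact norm_add₃_le.trans (add_le_add_three (h4.trans h8) h7 (h6.trans h9))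
        _ = _ := by
            rw [ha_succ]; push_cast
            linear_combination (-(a k) ^ 2) * hDκ
  set w := F^[n] x - u with hw
  have hwz : ‖w - z n‖ ≤ ε₀ / 4 := by
    have := (hind n le_rfl).trans (hquarter n le_rfl)
    rwa [han] at this
  have hzn : ‖z n‖ = ε₀ := by rw [hz_norm, han]
  have hwu : ‖w‖ ≤ 5 / 4 * ε₀ := by
    have := norm_le_norm_add_norm_sub' w (z n)
    linarith
  have hwl : 3 / 4 * ε₀ ≤ ‖w‖ := by
    have := norm_le_norm_add_norm_sub w (z n)
    linarith
  refine ⟨x, ?_, n, by linarith, fun y hy ↦ ?_⟩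
  · rw [hx, add_sub_cancel_left, norm_smul, hv1, mul_one, Real.norm_eq_abs,
      abs_of_pos (by positivity)]
    exact hδn
  -- A fixed point `u + t` near the iterate would have `t - A t` quadratically small, whereas `t` is
  -- within `ε₀ / 2` of `z n`, for which `‖z n - A (z n)‖` is nearly `(1 + κ) ε₀`. Since `‖1 - A‖ ≤
  -- 1 + κ`, this is impossible.
  · by_contra! hlt
    have h0 : F^[n] x - y = w - (y - u) := by rw [hw]; abel
    rw [h0] at hlt
    set t := y - u with ht
    have ht2 : ‖t‖ ≤ 2 * ε₀ := by
      have := norm_le_norm_add_norm_sub w t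
      linarith
    have h1 := hF y (by linarith)
    rw [hy] at h1
    have h2 : ‖t - A t‖ ≤ 4 * (C * ε₀) * ε₀ := by
      refine h1.trans ?_
      calc C * ‖t‖ ^ 2 ≤ C * (2 * ε₀) ^ 2 := by gcongr
        _ = _ := by ring
    have h2' : 4 * (C * ε₀) * ε₀ ≤ 4 * (1 / 16) * ε₀ := by gcongr
    have hIA : ∀ q : E, ‖q - A q‖ ≤ (1 + κ) * ‖q‖ := fun q ↦ by
      linarith [norm_sub_le q (A q), hA q]
    have h3 : (1 + κ) * ε₀ ≤ ‖z n - A (z n)‖ + ε₀ * μ := by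
      have h4 : (1 + κ) • z n = (z n - A (z n)) + ((-1) ^ n * a n) • (A v + κ • v) := by
        simp only [hz, map_smul]; module
      have h5 : ‖((-1) ^ n * a n) • (A v + κ • v)‖ ≤ ε₀ * μ := by
        rw [norm_smul]
        simp only [norm_mul, norm_pow, norm_neg, norm_one, one_pow, one_mul, Real.norm_eq_abs,
          han, abs_of_pos hε₀0]
        gcongr
      have h6 : ‖(1 + κ) • z n‖ = (1 + κ) * ε₀ := by
        rw [norm_smul, hzn, Real.norm_eq_abs, abs_of_pos (by linarith)]
      rw [← h6, h4]
      exact (norm_add_le _ _).trans (by gcongr)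
    have hμ8 : μ ≤ 1 / 8 := by
      rw [← hnμ]; have : (0 : ℝ) ≤ n := Nat.cast_nonneg n
      nlinarith
    have h7 : ‖z n - A (z n)‖ ≤ (1 + κ) * (ε₀ / 4) + (1 + κ) * (ε₀ / 4) + 4 * (C * ε₀) * ε₀ := by
      have h8 : z n - A (z n) = ((z n - w) - A (z n - w)) + ((w - t) - A (w - t)) + (t - A t) := by
        simp only [map_sub]; abel
      rw [h8]
      refine norm_add₃_le.trans (add_le_add_three ((hIA _).trans ?_) ((hIA _).trans ?_) h2)
      · rw [norm_sub_rev]; gcongr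
      · gcongr
    have h9 : ε₀ * μ ≤ ε₀ * (1 / 8) := by gcongr
    nlinarith

/-- If the linearization at a fixed point expands the range of `p` by the factor `κ > 1` and its
norm is smaller than `κ` on the kernel, the set of points with orbits that remain near the fixed
point has empty interior. -/
theorem interior_setOf_iterate_near_eq_empty {F : E → E} {A p : E →L[ℝ] E} {u e₀ : E} {κ ρ : ℝ}
    (hF : HasStrictFDerivAt F A u) (hκ : 1 < κ) (hρ : ρ < κ)
    (hp : ∀ x, ‖p (A x)‖ = κ * ‖p x‖) (hq : ∀ x, ‖A x - p (A x)‖ ≤ ρ * ‖x - p x‖)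
    (he₀ : e₀ ≠ 0) (hpe₀ : p e₀ = e₀) :
    ∃ ε > 0, interior {x | ∀ n, ‖F^[n] x - u‖ < ε} = ∅ := by
  set K : ℝ := 1 + ‖p‖ with hK
  have hK1 : 1 ≤ K := by rw [hK]; linarith [norm_nonneg p]
  have hpK : ∀ x, ‖p x‖ ≤ K * ‖x‖ := fun x ↦ (p.le_opNorm x).trans (by gcongr; linarith)
  have hqK : ∀ x, ‖x - p x‖ ≤ K * ‖x‖ := fun x ↦ by
    have h1 := norm_sub_le x (p x)
    have h2 := p.le_opNorm x
    rw [hK]; linarith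
  -- The first bound gives growth `κ - β ≥ 1 + β` inside the cone, the second gives `ρ + β ≤ κ - β`,
  -- which keeps the cone invariant.
  obtain ⟨β, hβ0, hβ1, hβ2⟩ : ∃ β, 0 < β ∧ β ≤ (κ - 1) / 2 ∧ 2 * β ≤ κ - ρ :=
    ⟨min ((κ - 1) / 2) ((κ - ρ) / 2), lt_min (by linarith) (by linarith), min_le_left _ _, by
      linarith [min_le_right ((κ - 1) / 2) ((κ - ρ) / 2)]⟩
  obtain ⟨ε, hε, hFε⟩ := exists_ball_norm_sub_le hF (η := β / (2 * K)) (by positivity)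
  refine ⟨ε, hε, ?_⟩
  by_contra hne
  obtain ⟨x, hx⟩ := Set.nonempty_iff_ne_empty.2 hne
  have hxmem := interior_subset hx
  have hcont : Tendsto (fun t : ℝ ↦ x + t • e₀) (𝓝[>] 0) (𝓝 x) := by
    have : Continuous fun t : ℝ ↦ x + t • e₀ := by fun_prop
    simpa using (this.tendsto 0).mono_left nhdsWithin_le_nhds
  obtain ⟨t, hty, ht0⟩ := ((hcont.eventually (isOpen_interior.mem_nhds hx)).and
    self_mem_nhdsWithin).exists
  have ht0 : 0 < t := ht0
  have hymem := interior_subset hty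
  set y := x + t • e₀ with hy
  set g := 1 + β with hg
  set z : ℕ → E := fun n ↦ F^[n] y - F^[n] x with hz
  -- Two orbits that start a multiple of `e₀` apart keep their difference in the cone around the
  -- range of `p`, where it grows geometrically; both cannot stay in one ball.
  have hcone : ∀ n, ‖z n - p (z n)‖ ≤ ‖p (z n)‖ ∧ g ^ n * (t * ‖e₀‖) ≤ ‖p (z n)‖ := by
    intro n
    induction n with
    | zero =>
      have h1 : z 0 = t • e₀ := by simp [hz, hy]
      rw [h1, map_smul, hpe₀, norm_smul, Real.norm_eq_abs, abs_of_pos ht0]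
      simp only [sub_self, norm_zero, pow_zero, one_mul, le_refl, and_true]
      positivity
    | succ n ih =>
      obtain ⟨h1, h2⟩ := ih
      have h3 := hFε _ _ (hymem n) (hxmem n)
      rw [← Function.iterate_succ_apply' F, ← Function.iterate_succ_apply' F] at h3
      change ‖z (n + 1) - A (z n)‖ ≤ β / (2 * K) * ‖z n‖ at h3
      set e := z (n + 1) - A (z n) with he
      have h4 : z (n + 1) = A (z n) + e := by rw [he]; abel
      have h5 : ‖z n‖ ≤ 2 * ‖p (z n)‖ := by
        have := norm_le_norm_add_norm_sub' (z n) (p (z n))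
        linarith
      have h6 : K * ‖e‖ ≤ β * ‖p (z n)‖ := by
        calc K * ‖e‖ ≤ K * (β / (2 * K) * (2 * ‖p (z n)‖)) := by
              gcongr; exact h3.trans (by gcongr)
          _ = _ := by field_simp
      have h7 : ‖p (z (n + 1))‖ ≥ κ * ‖p (z n)‖ - β * ‖p (z n)‖ := by
        rw [h4, map_add, ← hp]
        have := norm_sub_le_norm_add (p (A (z n))) (p e)
        linarith [hpK e]
      have h8 : ‖z (n + 1) - p (z (n + 1))‖ ≤ ρ * ‖z n - p (z n)‖ + β * ‖p (z n)‖ := by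
        have : z (n + 1) - p (z (n + 1)) = (A (z n) - p (A (z n))) + (e - p e) := by
          rw [h4, map_add]; abel
        rw [this]
        exact (norm_add_le _ _).trans (add_le_add (hq _) ((hqK e).trans h6))
      have hnn := norm_nonneg (p (z n))
      have hnn' := norm_nonneg (z n - p (z n))
      constructor
      · have h9 : ρ * ‖z n - p (z n)‖ ≤ (κ - 2 * β) * ‖p (z n)‖ := by
          calc ρ * ‖z n - p (z n)‖ ≤ (κ - 2 * β) * ‖z n - p (z n)‖ := by gcongr; linarith
            _ ≤ _ := by
              gcongr
              linarith
        linarith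
      · calc g ^ (n + 1) * (t * ‖e₀‖) = g * (g ^ n * (t * ‖e₀‖)) := by ring
          _ ≤ g * ‖p (z n)‖ := by gcongr
          _ ≤ (κ - β) * ‖p (z n)‖ := by gcongr; linarith
          _ ≤ _ := by linarith
  have hte : 0 < t * ‖e₀‖ := mul_pos ht0 (norm_pos_iff.2 he₀)
  obtain ⟨n, hn⟩ := pow_unbounded_of_one_lt (K * (2 * ε) / (t * ‖e₀‖)) (show 1 < g by linarith)
  rw [div_lt_iff₀ hte] at hn
  have h1 : ‖z n‖ ≤ 2 * ε := by
    have : z n = (F^[n] y - u) - (F^[n] x - u) := by simp [hz]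
    rw [this]
    linarith [norm_sub_le (F^[n] y - u) (F^[n] x - u), hymem n, hxmem n]
  have h2 : ‖p (z n)‖ ≤ K * (2 * ε) := (hpK _).trans (by gcongr)
  linarith [(hcone n).2]

end Dynamics

/-! ### The inner product defined by the acceleration operator. -/

section EnergySpace

universe u

variable {V : Type u} [NormedAddCommGroup V] [InnerProductSpace ℝ V]

/-- Positive definiteness alone would not give this in infinite dimension. Invertibility bounds `M`
below in norm, and for a positive operator that implies coercivity. -/
theorem IsAcceleration.exists_coercive [CompleteSpace V] {M : V ≃L[ℝ] StrongDual ℝ V}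
    (hM : IsAcceleration M) : ∃ c > 0, ∀ v, c * ‖v‖ ^ 2 ≤ M v v := by
  set T : V →L[ℝ] V :=
    InnerProductSpace.continuousLinearMapOfBilin (𝕜 := ℝ) (M : V →L[ℝ] V →L[ℝ] ℝ) with hT
  have hTM : ∀ v w, ⟪T v, w⟫ = M v w := fun v w ↦
    InnerProductSpace.continuousLinearMapOfBilin_apply _ v w
  have hnn : ∀ v, 0 ≤ M v v := fun v ↦ by
    rcases eq_or_ne v 0 with rfl | hv
    · simp
    · exact (hM.posDef v hv).le
  have hpos : T.IsPositive := isPositive_of_symm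
    (fun x y ↦ by rw [hTM, ← real_inner_comm x (T y), hTM, hM.hermitian])
    (fun x ↦ by rw [hTM]; exact hnn x)
  obtain ⟨γ, hγ, h⟩ := exists_coercive_of_norm_le hpos
    (c := (‖(M.symm : StrongDual ℝ V →L[ℝ] V)‖ + 1)⁻¹) (by positivity) (s := Set.univ)
    fun x _ ↦ by
      have h1 : ‖M x‖ ≤ ‖T x‖ := by
        refine ContinuousLinearMap.opNorm_le_bound _ (norm_nonneg _) fun w ↦ ?_
        rw [← hTM]
        exact norm_inner_le_norm _ _
      refine le_trans ?_ h1
      rw [inv_mul_le_iff₀ (by positivity)]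
      have h2 := (M.symm : StrongDual ℝ V →L[ℝ] V).le_opNorm (M x)
      rw [ContinuousLinearEquiv.coe_coe, M.symm_apply_apply] at h2
      linarith [norm_nonneg (M x)]
  exact ⟨γ, hγ, fun v ↦ by rw [← hTM]; exact h v trivial⟩

/-- A copy of `V` that carries the inner product `⟨M v, w⟩`. -/
def EnergySpace (_M : V ≃L[ℝ] StrongDual ℝ V) : Type u := V

instance (M : V ≃L[ℝ] StrongDual ℝ V) : AddCommGroup (EnergySpace M) :=
  inferInstanceAs (AddCommGroup V)

instance (M : V ≃L[ℝ] StrongDual ℝ V) : Module ℝ (EnergySpace M) :=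
  inferInstanceAs (Module ℝ V)

/-- The identity of `V`, as a map to its energy space. -/
def toEnergy (M : V ≃L[ℝ] StrongDual ℝ V) : V ≃ₗ[ℝ] EnergySpace M := LinearEquiv.refl ℝ V

/-- The inner product `⟨M v, w⟩`. -/
abbrev IsAcceleration.core {M : V ≃L[ℝ] StrongDual ℝ V} (hM : IsAcceleration M) :
    InnerProductSpace.Core ℝ (EnergySpace M) where
  inner v w := M ((toEnergy M).symm v) ((toEnergy M).symm w)
  conj_inner_symm v w := by simpa using hM.hermitian _ _
  re_inner_nonneg v := by
    rcases eq_or_ne ((toEnergy M).symm v) 0 with h | h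
    · simp [h]
    · simpa using (hM.posDef _ h).le
  add_left v w z := by simp
  smul_left v w r := by simp
  definite v h := by
    by_contra hv
    exact (hM.posDef ((toEnergy M).symm v) (by simpa using hv)).ne' h

/-- Boundedness and coercivity of `M` make the energy norm equivalent to the original one, so
completeness carries over. -/
theorem IsAcceleration.exists_hilbertSpace [CompleteSpace V] {M : V ≃L[ℝ] StrongDual ℝ V}
    (hM : IsAcceleration M) : ∃ (H : Type u) (_ : NormedAddCommGroup H)
      (_ : InnerProductSpace ℝ H) (_ : CompleteSpace H) (e : V ≃L[ℝ] H),
      ∀ v w, ⟪e v, e w⟫ = M v w := by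
  let _ : NormedAddCommGroup (EnergySpace M) := hM.core.toNormedAddCommGroup
  let _ : InnerProductSpace ℝ (EnergySpace M) := InnerProductSpace.ofCore hM.core.toCore
  have hinner : ∀ v w : V, ⟪toEnergy M v, toEnergy M w⟫ = M v w := fun v w ↦ rfl
  obtain ⟨c, hc, hcM⟩ := hM.exists_coercive
  have hnorm : ∀ v, ‖toEnergy M v‖ ^ 2 = M v v := fun v ↦ by
    rw [← real_inner_self_eq_norm_sq, hinner]
  have hle : ∀ v, ‖toEnergy M v‖ ≤ (‖(M : V →L[ℝ] StrongDual ℝ V)‖ + 1) * ‖v‖ := fun v ↦ by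
    refine le_of_sq_le_sq ?_ (by positivity)
    have h1 := (M : V →L[ℝ] StrongDual ℝ V).le_opNorm₂ v v
    have h2 := le_abs_self (M v v)
    have h3 := norm_nonneg (M : V →L[ℝ] StrongDual ℝ V)
    rw [ContinuousLinearEquiv.coe_coe, Real.norm_eq_abs] at h1
    rw [hnorm, mul_pow]
    nlinarith [sq_nonneg ‖v‖, mul_nonneg h3 (sq_nonneg ‖v‖),
      mul_nonneg (mul_nonneg h3 h3) (sq_nonneg ‖v‖)]
  have hge : ∀ v, ‖(toEnergy M).symm v‖ ≤ (Real.sqrt c)⁻¹ * ‖v‖ := fun v ↦ by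
    rw [le_inv_mul_iff₀ (Real.sqrt_pos.2 hc)]
    refine le_of_sq_le_sq ?_ (norm_nonneg _)
    have h1 := hcM ((toEnergy M).symm v)
    rw [← hnorm, LinearEquiv.apply_symm_apply] at h1
    rwa [mul_pow, Real.sq_sqrt hc.le]
  let e : V ≃L[ℝ] EnergySpace M := (toEnergy M).toContinuousLinearEquivOfBounds _ _ hle hge
  exact ⟨EnergySpace M, inferInstance, inferInstance,
    (completeSpace_congr (e := e.toEquiv) e.isUniformEmbedding).1 inferInstance, e, hinner⟩

end EnergySpace

/-! ### Expansion of the iteration step near a solution. -/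

section Expansion

variable {V : Type*} [NormedAddCommGroup V] [InnerProductSpace ℝ V]

/-- A quadratic error of the linearization makes the linearization Lipschitz continuous. -/
theorem IsLinearizableNear.exists_lipschitz {L₀ : V → StrongDual ℝ V} {u : V}
    (h : IsLinearizableNear L₀ u) : ∃ r > 0, ∃ C ≥ 0,
      (∀ x y, ‖x - u‖ < r → ‖y - u‖ < r →
        ‖L₀ x - L₀ y - linearized L₀ y (x - y)‖ ≤ C * ‖x - y‖ ^ 2) ∧
      ∀ x y, ‖x - u‖ < r → ‖y - u‖ < r →
        ‖linearized L₀ x - linearized L₀ y‖ ≤ C * ‖x - y‖ := by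
  obtain ⟨r, hr, C₀, hC₀⟩ := h
  set C := max C₀ 0 with hCdef
  have hC0 : 0 ≤ C := le_max_right _ _
  have hC : ∀ v w : V, ‖v - u‖ < r → ‖w‖ < r →
      ‖L₀ (v + w) - L₀ v - linearized L₀ v w‖ ≤ C * ‖w‖ ^ 2 := fun v w hv hw ↦
    (hC₀ v w hv hw).trans (by gcongr; exact le_max_left _ _)
  have hdist : ∀ x y, ‖x - u‖ < r / 4 → ‖y - u‖ < r / 4 → ‖x - y‖ < r / 2 := fun x y hx hy ↦ by
    have := norm_sub_le (x - u) (y - u)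
    rw [sub_sub_sub_cancel_right] at this
    linarith
  refine ⟨r / 4, by positivity, 6 * C, by positivity, fun x y hx hy ↦ ?_, fun x y hx hy ↦ ?_⟩
  · have h1 := hC y (x - y) (by linarith) (by linarith [hdist x y hx hy])
    rw [add_sub_cancel] at h1
    nlinarith [sq_nonneg ‖x - y‖, mul_nonneg hC0 (sq_nonneg ‖x - y‖)]
  · rcases eq_or_ne x y with rfl | hxy
    · refine ContinuousLinearMap.opNorm_le_bound _ (by positivity) fun w ↦ ?_
      rw [sub_apply, sub_self, norm_zero]
      positivity
    set d := ‖x - y‖ with hd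
    have hd0 : 0 < d := norm_pos_iff.2 (sub_ne_zero.2 hxy)
    have hdr : d < r / 2 := hdist x y hx hy
    -- The value at `x + w` is expanded from `x` and from `y`, and that at `x` from `y`. For `‖w‖ =
    -- d` the three errors add up to at most `C (d² + 4 d² + d²)`, hence the constant `6`;
    -- homogeneity then gives all `w`.
    have hsphere : ∀ w, ‖w‖ = d →
        ‖(linearized L₀ x - linearized L₀ y) w‖ ≤ 6 * C * d * ‖w‖ := by
      intro w hw
      have hsum : ‖x - y + w‖ ≤ 2 * d := by linarith [norm_add_le (x - y) w]
      have h1 := hC x w (by linarith) (by linarith)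
      have h2 := hC y (x - y + w) (by linarith) (by linarith)
      have h3 := hC y (x - y) (by linarith) (by linarith)
      rw [← add_assoc, add_sub_cancel] at h2
      rw [add_sub_cancel] at h3
      have h4 : (linearized L₀ x - linearized L₀ y) w
          = (L₀ (x + w) - L₀ y - linearized L₀ y (x - y + w))
            - (L₀ (x + w) - L₀ x - linearized L₀ x w)
            - (L₀ x - L₀ y - linearized L₀ y (x - y)) := by
        rw [map_add, sub_apply]; abel
      have h5 : C * ‖x - y + w‖ ^ 2 ≤ C * (2 * d) ^ 2 := by gcongr
      rw [hw] at h1 ⊢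
      rw [h4]
      refine (norm_sub_le _ _).trans ((add_le_add_left (norm_sub_le _ _) _).trans ?_)
      nlinarith
    refine ContinuousLinearMap.opNorm_le_bound _ (by positivity) fun w ↦ ?_
    rcases eq_or_ne w 0 with rfl | hw
    · simp
    have hw0 : 0 < ‖w‖ := norm_pos_iff.2 hw
    have h1 := hsphere ((d / ‖w‖) • w) (by
      rw [norm_smul, Real.norm_eq_abs, abs_of_pos (by positivity)]; field_simp)
    rw [map_smul, norm_smul, norm_smul, mul_left_comm] at h1
    exact le_of_mul_le_mul_left h1 (by rw [Real.norm_eq_abs]; positivity)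

/-- The linearization `1 + Δt 𝓛` of the squared-operator step, with a quadratic error. -/
theorem exists_norm_step_sub_le (M : V ≃L[ℝ] StrongDual ℝ V) {L₀ : V → StrongDual ℝ V} {u : V}
    (hL₀ : IsLinearizableNear L₀ u) (hu : L₀ u = 0) (Δt : ℝ) :
    ∃ r > 0, ∃ K ≥ 0, ∀ x y, ‖x - u‖ < r → ‖y - u‖ < r →
      ‖step M L₀ Δt x - step M L₀ Δt y - (1 + Δt • curlyL M L₀ u) (x - y)‖
        ≤ K * (‖x - u‖ + ‖y - u‖) * ‖x - y‖ := by
  obtain ⟨r, hr, C, hC, hquad, hlip⟩ := hL₀.exists_lipschitz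
  set N : StrongDual ℝ V →L[ℝ] V := (M.symm : StrongDual ℝ V →L[ℝ] V) with hN
  set L := linearized L₀ u with hL
  have huu : ‖u - u‖ < r := by simpa using hr
  have hdag : ∀ x y, ‖dagger (linearized L₀ x) - dagger (linearized L₀ y)‖
      = ‖linearized L₀ x - linearized L₀ y‖ := fun x y ↦ by
    rw [← ContinuousLinearMap.opNorm_flip (linearized L₀ x - linearized L₀ y)]
    rfl
  set B := C * r + ‖L‖ with hB
  have hB0 : 0 ≤ B := by positivity
  refine ⟨r, hr, |Δt| * (‖N‖ * ((‖dagger L‖ + C * r) * (‖N‖ * (2 * C)) + C * (‖N‖ * B)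
    + C * (‖N‖ * ‖L‖))), by positivity, fun x y hx hy ↦ ?_⟩
  set s := ‖x - u‖ + ‖y - u‖ with hs
  set d := ‖x - y‖ with hd
  have hd0 : 0 ≤ d := norm_nonneg _
  have hs0 : 0 ≤ s := by positivity
  have hxs : ‖x - u‖ ≤ s := by linarith [norm_nonneg (y - u)]
  have hys : ‖y - u‖ ≤ s := by linarith [norm_nonneg (x - u)]
  have hds : d ≤ s := by
    have := norm_sub_le (x - u) (y - u)
    rwa [sub_sub_sub_cancel_right] at this
  have h1 : ‖L₀ x - L₀ y - L (x - y)‖ ≤ 2 * C * (s * d) := by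
    have e1 : L₀ x - L₀ y - L (x - y) = (L₀ x - L₀ y - linearized L₀ y (x - y))
        + (linearized L₀ y - L) (x - y) := by rw [sub_apply]; abel
    have e2 : ‖(linearized L₀ y - L) (x - y)‖ ≤ C * s * d :=
      (ContinuousLinearMap.le_opNorm _ _).trans
        (by gcongr; exact (hlip y u hy huu).trans (by gcongr))
    have e3 : C * d ^ 2 ≤ C * (s * d) := by rw [sq]; gcongr
    rw [e1]
    refine (norm_add_le _ _).trans ?_
    linarith [hquad x y hx hy]
  have h2 : ‖L₀ y‖ ≤ B * s := by
    have e1 : L₀ y = (L₀ y - L₀ u - L (y - u)) + L (y - u) := by rw [hu]; abel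
    have e2 := hquad y u hy huu
    have e3 : C * ‖y - u‖ ^ 2 ≤ C * (r * s) := by rw [sq]; gcongr
    have e4 : ‖L (y - u)‖ ≤ ‖L‖ * s := (L.le_opNorm _).trans (by gcongr)
    rw [e1]
    refine (norm_add_le _ _).trans ?_
    rw [hB]
    linarith
  have h3 : ‖dagger (linearized L₀ x)‖ ≤ ‖dagger L‖ + C * r := by
    have e1 := norm_le_norm_add_norm_sub' (dagger (linearized L₀ x)) (dagger L)
    have e2 : C * ‖x - u‖ ≤ C * r := by gcongr
    rw [hL, hdag] at e1
    linarith [hlip x u hx huu]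
  have h4 : ‖dagger (linearized L₀ x) - dagger (linearized L₀ y)‖ ≤ C * d := by
    rw [hdag]; exact hlip x y hx hy
  have h5 : ‖dagger (linearized L₀ x) - dagger L‖ ≤ C * s := by
    rw [hL, hdag]; exact (hlip x u hx huu).trans (by gcongr)
  -- Three error sources: the remainder of `L₀`, the change of the adjoint between `x` and `y`
  -- (multiplied by `L₀ y`, which is small because `L₀ u = 0`), and the change of the adjoint
  -- between `x` and `u`. Each is at most a constant times `s * d`.
  have key : step M L₀ Δt x - step M L₀ Δt y - (1 + Δt • curlyL M L₀ u) (x - y)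
      = -(Δt • N (dagger (linearized L₀ x) (N (L₀ x - L₀ y - L (x - y)))
        + (dagger (linearized L₀ x) - dagger (linearized L₀ y)) (N (L₀ y))
        + (dagger (linearized L₀ x) - dagger L) (N (L (x - y))))) := by
    have e1 : (1 + Δt • curlyL M L₀ u) (x - y)
        = (x - y) - Δt • N (dagger L (N (L (x - y)))) := by
      simp only [curlyL, add_apply, one_apply_eq_self, smul_apply, neg_apply,
        ContinuousLinearMap.comp_apply, smul_neg, ← hN, ← hL]
      abel
    rw [e1]
    simp only [step, map_add, map_sub, sub_apply]
    change x - Δt • N (dagger (linearized L₀ x) (N (L₀ x)))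
      - (y - Δt • N (dagger (linearized L₀ y) (N (L₀ y)))) - _ = _
    module
  rw [key, norm_neg, norm_smul, Real.norm_eq_abs]
  have b1 : ‖dagger (linearized L₀ x) (N (L₀ x - L₀ y - L (x - y)))‖
      ≤ (‖dagger L‖ + C * r) * (‖N‖ * (2 * C * (s * d))) :=
    (ContinuousLinearMap.le_opNorm _ _).trans
      (mul_le_mul h3 ((N.le_opNorm _).trans (by gcongr)) (norm_nonneg _) (by positivity))
  have b2 : ‖(dagger (linearized L₀ x) - dagger (linearized L₀ y)) (N (L₀ y))‖
      ≤ (C * d) * (‖N‖ * (B * s)) :=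
    (ContinuousLinearMap.le_opNorm _ _).trans
      (mul_le_mul h4 ((N.le_opNorm _).trans (by gcongr)) (norm_nonneg _) (by positivity))
  have b3 : ‖(dagger (linearized L₀ x) - dagger L) (N (L (x - y)))‖
      ≤ (C * s) * (‖N‖ * (‖L‖ * d)) :=
    (ContinuousLinearMap.le_opNorm _ _).trans
      (mul_le_mul h5 ((N.le_opNorm _).trans (by gcongr; exact L.le_opNorm _))
        (norm_nonneg _) (by positivity))
  have b4 := norm_add₃_le.trans (add_le_add_three b1 b2 b3)
  calc _ ≤ |Δt| * (‖N‖ * _) := by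
        gcongr
        exact (N.le_opNorm _).trans (mul_le_mul_of_nonneg_left b4 (norm_nonneg _))
    _ = _ := by ring

theorem iterate_eq (M : V ≃L[ℝ] StrongDual ℝ V) (L₀ : V → StrongDual ℝ V) (Δt : ℝ) (u₀ : V)
    (n : ℕ) : iterate M L₀ Δt u₀ n = (step M L₀ Δt)^[n] u₀ := by
  induction n with
  | zero => rfl
  | succ n ih => rw [Function.iterate_succ_apply', ← ih]; rfl

theorem step_eq_self (M : V ≃L[ℝ] StrongDual ℝ V) {L₀ : V → StrongDual ℝ V} (Δt : ℝ) {v : V}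
    (hv : L₀ v = 0) : step M L₀ Δt v = v := by
  simp [step, hv]

end Expansion

/-! ### Norm bounds for affine functions of a positive operator. -/

section Operators

variable {H : Type*} [NormedAddCommGroup H] [InnerProductSpace ℝ H]

/-- The operator form of `(a + b t)² ≤ a² + b (2 a + b p) t`, valid for `t² ≤ p t`. All norm
estimates of `1 + Δt 𝓛` below come from it. -/
theorem norm_sq_smul_add_le {P : H →L[ℝ] H} {p : ℝ} (h : ∀ x, ‖P x‖ ^ 2 ≤ p * ⟪P x, x⟫)
    (a b : ℝ) (x : H) :
    ‖a • x + b • P x‖ ^ 2 ≤ a ^ 2 * ‖x‖ ^ 2 + b * (2 * a + b * p) * ⟪P x, x⟫ := by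
  have h1 : b ^ 2 * ‖P x‖ ^ 2 ≤ b ^ 2 * (p * ⟪P x, x⟫) := by gcongr; exact h x
  rw [norm_add_sq_real, norm_smul, norm_smul, mul_pow, mul_pow, Real.norm_eq_abs,
    Real.norm_eq_abs, sq_abs, sq_abs, real_inner_smul_left, real_inner_smul_right,
    real_inner_comm (P x) x]
  linarith

/-- For `c < 0` the hypothesis forces `y = 0`, in agreement with the value `0` of `Real.sqrt` there.
-/
theorem norm_le_sqrt_mul_of_sq_le {E : Type*} [NormedAddCommGroup E] {x y : E} {c : ℝ}
    (h : ‖y‖ ^ 2 ≤ c * ‖x‖ ^ 2) : ‖y‖ ≤ Real.sqrt c * ‖x‖ := by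
  have := Real.sqrt_le_sqrt h
  rwa [Real.sqrt_sq (norm_nonneg _), Real.sqrt_mul' _ (sq_nonneg _),
    Real.sqrt_sq (norm_nonneg _)] at this

theorem starProjection_ker_apply_eq_zero {P : H →L[ℝ] H} [P.ker.HasOrthogonalProjection]
    (hP : P.IsPositive) (x : H) : P.ker.starProjection (P x) = 0 := by
  rw [Submodule.starProjection_apply_eq_zero_iff, Submodule.mem_orthogonal']
  intro y hy
  have : P y = 0 := hy
  rw [hP.inner_left_eq_inner_right, this, inner_zero_right]

theorem apply_starProjection_ker {P : H →L[ℝ] H} [P.ker.HasOrthogonalProjection] (x : H) :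
    P (P.ker.starProjection x) = 0 :=
  P.ker.starProjection_apply_mem x

end Operators

/-! ### Transfer of the iteration to the energy space. -/

section Transfer

variable {V : Type*} [NormedAddCommGroup V] [InnerProductSpace ℝ V]
  {H : Type*} [NormedAddCommGroup H] [InnerProductSpace ℝ H]
  {M : V ≃L[ℝ] StrongDual ℝ V} {L₀ : V → StrongDual ℝ V} {e : V ≃L[ℝ] H}

/-- The operator `𝓛`, on a Hilbert space that is isomorphic to `V`. -/
def energyL (M : V ≃L[ℝ] StrongDual ℝ V) (L₀ : V → StrongDual ℝ V) (e : V ≃L[ℝ] H) (u : V) :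
    H →L[ℝ] H := e.conjContinuousAlgEquiv (curlyL M L₀ u)

/-- The step of the squared-operator method, on a Hilbert space that is isomorphic to `V`. -/
def energyStep (M : V ≃L[ℝ] StrongDual ℝ V) (L₀ : V → StrongDual ℝ V) (e : V ≃L[ℝ] H) (Δt : ℝ)
    (x : H) : H := e (step M L₀ Δt (e.symm x))

theorem energyL_apply (u : V) (x : H) :
    energyL M L₀ e u x = e (curlyL M L₀ u (e.symm x)) := rfl

theorem spectrum_energyL (u : V) :
    spectrum ℝ (energyL M L₀ e u) = spectrum ℝ (curlyL M L₀ u) :=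
  AlgEquiv.spectrum_eq e.conjContinuousAlgEquiv.toAlgEquiv _

theorem energyStep_iterate (Δt : ℝ) (v : V) (n : ℕ) :
    (energyStep M L₀ e Δt)^[n] (e v) = e (iterate M L₀ Δt v n) := by
  rw [iterate_eq]
  induction n with
  | zero => rfl
  | succ n ih =>
    rw [Function.iterate_succ_apply', ih, Function.iterate_succ_apply', energyStep,
      e.symm_apply_apply]

/-- This is `𝓛 = -B* B` with `B = M⁻¹ L₁`: in the energy inner product `M⁻¹ L₁†` is the adjoint of
`B`. Symmetry, sign and kernel of `𝓛` follow. -/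
theorem inner_energyL (hM : IsAcceleration M) (he : ∀ v w, ⟪e v, e w⟫ = M v w) (u : V) (x y : H) :
    ⟪energyL M L₀ e u x, y⟫ = -⟪e (M.symm (linearized L₀ u (e.symm x))),
      e (M.symm (linearized L₀ u (e.symm y)))⟫ := by
  obtain ⟨v, rfl⟩ := e.surjective x
  obtain ⟨w, rfl⟩ := e.surjective y
  rw [energyL_apply, he, he, e.symm_apply_apply, e.symm_apply_apply, hM.hermitian (M.symm _),
    M.apply_symm_apply]
  have h1 : curlyL M L₀ u v
      = -M.symm (dagger (linearized L₀ u) (M.symm (linearized L₀ u v))) := rfl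
  rw [h1, map_neg, M.apply_symm_apply]
  rfl

theorem isPositive_neg_energyL (hM : IsAcceleration M) (he : ∀ v w, ⟪e v, e w⟫ = M v w) (u : V) :
    (-energyL M L₀ e u).IsPositive := by
  refine isPositive_of_symm (fun x y ↦ ?_) (fun x ↦ ?_)
  · rw [neg_apply, neg_apply, inner_neg_left, inner_neg_right,
      ← real_inner_comm x (energyL M L₀ e u y), inner_energyL hM he, inner_energyL hM he,
      real_inner_comm]
  · rw [neg_apply, inner_neg_left, inner_energyL hM he, neg_neg]
    exact real_inner_self_nonneg

theorem linearized_eq_zero_of_energyL (hM : IsAcceleration M) (he : ∀ v w, ⟪e v, e w⟫ = M v w)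
    {u : V} {x : H} (hx : energyL M L₀ e u x = 0) : linearized L₀ u (e.symm x) = 0 := by
  have h1 := inner_energyL (L₀ := L₀) hM he u x x
  rw [hx, inner_zero_left, zero_eq_neg, inner_self_eq_zero] at h1
  simpa using h1

end Transfer

theorem hasStrictFDerivAt_of_norm_sub_le {E : Type*} [NormedAddCommGroup E] [NormedSpace ℝ E]
    {F : E → E} {A : E →L[ℝ] E} {a : E} {r K : ℝ} (hr : 0 < r) (hK : 0 ≤ K)
    (h : ∀ x y, ‖x - a‖ < r → ‖y - a‖ < r →
      ‖F x - F y - A (x - y)‖ ≤ K * (‖x - a‖ + ‖y - a‖) * ‖x - y‖) : HasStrictFDerivAt F A a := by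
  refine .of_isLittleO (Asymptotics.isLittleO_iff.2 fun c hc ↦ ?_)
  have hρ : 0 < min r (c / (2 * (K + 1))) := by positivity
  filter_upwards [Metric.ball_mem_nhds (a, a) hρ] with q hq
  rw [Metric.mem_ball, Prod.dist_eq, max_lt_iff, dist_eq_norm, dist_eq_norm] at hq
  refine (h q.1 q.2 (hq.1.trans_le (min_le_left _ _)) (hq.2.trans_le (min_le_left _ _))).trans ?_
  have h1 := hq.1.le.trans (min_le_right _ _)
  have h2 := hq.2.le.trans (min_le_right _ _)
  gcongr
  calc K * (‖q.1 - a‖ + ‖q.2 - a‖) ≤ (K + 1) * (c / (2 * (K + 1)) + c / (2 * (K + 1))) := by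
        gcongr; linarith
    _ = c := by field_simp; ring

section Transfer

variable {V : Type*} [NormedAddCommGroup V] [InnerProductSpace ℝ V]
  {H : Type*} [NormedAddCommGroup H] [InnerProductSpace ℝ H]
  {M : V ≃L[ℝ] StrongDual ℝ V} {L₀ : V → StrongDual ℝ V} {e : V ≃L[ℝ] H}

theorem exists_bound_equiv {V H : Type*} [NormedAddCommGroup V] [NormedSpace ℝ V]
    [NormedAddCommGroup H] [NormedSpace ℝ H] (e : V ≃L[ℝ] H) : ∃ B > 0, ∀ v, ‖e v‖ ≤ B * ‖v‖ :=
  (e : V →L[ℝ] H).isBoundedLinearMap.bound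

theorem exists_norm_energyStep_sub_le {u : V} (hL₀ : IsLinearizableNear L₀ u) (hu : L₀ u = 0)
    (Δt : ℝ) : ∃ r > 0, ∃ K ≥ 0, ∀ x y, ‖x - e u‖ < r → ‖y - e u‖ < r →
      ‖energyStep M L₀ e Δt x - energyStep M L₀ e Δt y - (1 + Δt • energyL M L₀ e u) (x - y)‖
        ≤ K * (‖x - e u‖ + ‖y - e u‖) * ‖x - y‖ := by
  obtain ⟨r, hr, K, hK, h⟩ := exists_norm_step_sub_le M hL₀ hu Δt
  obtain ⟨B, hB, hBe⟩ := exists_bound_equiv e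
  obtain ⟨B', hB', hBe'⟩ := exists_bound_equiv e.symm
  refine ⟨r / B', by positivity, B * (K * B' * B'), by positivity, fun x y hx hy ↦ ?_⟩
  obtain ⟨v, rfl⟩ := e.surjective x
  obtain ⟨w, rfl⟩ := e.surjective y
  have hsub : ∀ a b : V, ‖a - b‖ ≤ B' * ‖e a - e b‖ := fun a b ↦ by
    simpa using hBe' (e a - e b)
  rw [lt_div_iff₀ hB'] at hx hy
  have h1 := h v w (by linarith [hsub v u]) (by linarith [hsub w u])
  have h2 : energyStep M L₀ e Δt (e v) - energyStep M L₀ e Δt (e w)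
      - (1 + Δt • energyL M L₀ e u) (e v - e w)
      = e (step M L₀ Δt v - step M L₀ Δt w - (1 + Δt • curlyL M L₀ u) (v - w)) := by
    simp [energyStep, energyL_apply, smul_sub]
  rw [h2]
  calc _ ≤ B * (K * (‖v - u‖ + ‖w - u‖) * ‖v - w‖) := (hBe _).trans (by gcongr)
    _ ≤ B * (K * (B' * ‖e v - e u‖ + B' * ‖e w - e u‖) * (B' * ‖e v - e w‖)) := by
      gcongr <;> exact hsub _ _
    _ = _ := by ring

theorem energyStep_eq_self {v : V} (Δt : ℝ) (hv : L₀ v = 0) :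
    energyStep M L₀ e Δt (e v) = e v := by
  rw [energyStep, e.symm_apply_apply, step_eq_self M Δt hv]

theorem symm_of_isPositive_neg {T : H →L[ℝ] H} (hT : (-T).IsPositive) (x y : H) :
    ⟪T x, y⟫ = ⟪x, T y⟫ := by
  simpa using hT.inner_left_eq_inner_right x y

theorem inner_sub_algebraMap (T : H →L[ℝ] H) (l : ℝ) (x y : H) :
    ⟪(T - algebraMap ℝ _ l) x, y⟫ = ⟪T x, y⟫ - l * ⟪x, y⟫ := by
  simp [Algebra.algebraMap_eq_smul_one, inner_sub_left, real_inner_smul_left]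

theorem mem_spectrum_sub_algebraMap {T : H →L[ℝ] H} {l m : ℝ} :
    m ∈ spectrum ℝ (T - algebraMap ℝ (H →L[ℝ] H) l) ↔ m + l ∈ spectrum ℝ T := by
  rw [spectrum.mem_iff, spectrum.mem_iff, map_add]
  congr! 2
  abel

theorem one_add_smul_apply_eq (T : H →L[ℝ] H) (Δt l : ℝ) (x : H) :
    (1 + Δt • T) x = (1 + Δt * l) • x + Δt • (T - algebraMap ℝ (H →L[ℝ] H) l) x := by
  simp only [add_apply, one_apply_eq_self, smul_apply, sub_apply, Algebra.algebraMap_eq_smul_one]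
  module

/-! ### From the spectrum of `𝓛` to convergence and divergence. -/

variable [CompleteSpace H]

theorem neg_of_mem_spectrum {T : H →L[ℝ] H} (hT : (-T).IsPositive) {l : ℝ}
    (hl : l ∈ spectrum ℝ T) (hl0 : l ≠ 0) : l < 0 := by
  by_contra! hcon
  have hpos : 0 < l := lt_of_le_of_ne hcon hl0.symm
  refine spectrum.mem_iff.1 hl (isUnit_of_coercive hpos fun x ↦ ?_)
  have := hT.inner_nonneg_left x
  simp only [neg_apply, inner_neg_left] at this
  simp only [sub_apply, Algebra.algebraMap_eq_smul_one, smul_apply, one_apply_eq_self,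
    inner_sub_left, real_inner_smul_left, real_inner_self_eq_norm_sq]
  linarith

theorem isPositive_sub_isLeast_spectrum {T : H →L[ℝ] H} (hT : (-T).IsPositive) {l : ℝ}
    (hl : IsLeast (spectrum ℝ T) l) : (T - algebraMap ℝ (H →L[ℝ] H) l).IsPositive := by
  have hsymm := symm_of_isPositive_neg hT
  refine isPositive_of_symm (fun x y ↦ ?_) fun x ↦ ?_
  · rw [inner_sub_algebraMap, hsymm, ← real_inner_comm x ((T - _) y), inner_sub_algebraMap,
      real_inner_comm x (T y), real_inner_comm x y]
  · rw [inner_sub_algebraMap, real_inner_self_eq_norm_sq]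
    linarith [le_inner_of_forall_notMem_spectrum hsymm
      (fun m hm hmem ↦ absurd (hl.2 hmem) (not_le.2 hm)) x]

/-- Since `l ≤ T ≤ 0` as forms, the shifted operator `T - l` lies between `0` and `-l`. -/
theorem norm_sub_isLeast_spectrum_sq_le {T : H →L[ℝ] H} (hT : (-T).IsPositive) {l : ℝ}
    (hl : IsLeast (spectrum ℝ T) l) (hl0 : l < 0) (x : H) :
    ‖(T - algebraMap ℝ (H →L[ℝ] H) l) x‖ ^ 2
      ≤ -l * ⟪(T - algebraMap ℝ (H →L[ℝ] H) l) x, x⟫ := by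
  refine norm_sq_le_of_inner_le (isPositive_sub_isLeast_spectrum hT hl) (by linarith)
    (fun y ↦ ?_) x
  have := hT.inner_nonneg_left y
  rw [neg_apply, inner_neg_left] at this
  rw [inner_sub_algebraMap, real_inner_self_eq_norm_sq]
  linarith

theorem convergesNear_of_lt {s : ℕ} {U : EuclideanSpace ℝ (Fin s) → V}
    {c₀ : EuclideanSpace ℝ (Fin s)} (hM : IsAcceleration M) (he : ∀ v w, ⟪e v, e w⟫ = M v w)
    (hL₀ : IsLinearizableNear L₀ (U c₀)) (hker : KernelAssumption L₀ U c₀) {l : ℝ}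
    (hl : IsLeast (spectrum ℝ (curlyL M L₀ (U c₀))) l) (hl0 : l < 0) {l' : ℝ} (hl' : l' < 0)
    (hgap : ∀ m ∈ spectrum ℝ (curlyL M L₀ (U c₀)), m ≠ 0 → m ≤ l') {Δt : ℝ} (h0 : 0 < Δt)
    (hΔt : Δt * (-l) < 2) : ConvergesNear M L₀ U c₀ Δt := by
  have hu : L₀ (U c₀) = 0 := hker.solution.self_of_nhds
  rw [← spectrum_energyL (e := e)] at hl hgap
  set T := energyL M L₀ e (U c₀) with hTdef
  have hT : (-T).IsPositive := isPositive_neg_energyL hM he _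
  set P : H →L[ℝ] H := -T with hPdef
  have hPle : ∀ x, ‖P x‖ ^ 2 ≤ -l * ⟪P x, x⟫ := norm_sq_le_of_inner_le hT (by linarith) fun x ↦ by
    have := (isPositive_sub_isLeast_spectrum hT hl).inner_nonneg_left x
    rw [inner_sub_algebraMap, real_inner_self_eq_norm_sq] at this
    rw [hPdef, neg_apply, inner_neg_left]
    linarith
  obtain ⟨γ, hγ, hγP⟩ := exists_coercive_orthogonal_ker hT (γ := -l') (by linarith)
    fun m hm hm0 ↦ by
      rw [hPdef, ← spectrum.neg_eq, Set.mem_neg] at hm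
      linarith [hgap _ hm (neg_ne_zero.2 hm0)]
  have : CompleteSpace P.ker := P.isClosed_ker.completeSpace_coe
  set p : H →L[ℝ] H := P.ker.starProjection with hpdef
  set A : H →L[ℝ] H := 1 + Δt • T with hAdef
  have hAx : ∀ x, A x = (1 : ℝ) • x + (-Δt) • P x := fun x ↦ by
    simp [hAdef, hPdef]
  -- With `P = -𝓛 ≤ -l`, one has `‖x - Δt P x‖² ≤ ‖x‖² - κ ⟪P x, x⟫`; the time step restriction is
  -- exactly `κ > 0`.
  set κ : ℝ := Δt * (2 - Δt * (-l)) with hκ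
  have hκ0 : 0 < κ := mul_pos h0 (by linarith)
  have hρ : Real.sqrt (1 - κ * γ) < 1 := by
    rw [Real.sqrt_lt' one_pos]; nlinarith [mul_pos hκ0 hγ]
  have hA : ∀ x, ‖A (x - p x)‖ ≤ Real.sqrt (1 - κ * γ) * ‖x - p x‖ := fun x ↦ by
    refine norm_le_sqrt_mul_of_sq_le ?_
    have h1 := norm_sq_smul_add_le hPle 1 (-Δt) (x - p x)
    have h2 := hγP (x - p x) (P.ker.sub_starProjection_mem_orthogonal x)
    rw [hAx]
    have h3 := mul_le_mul_of_nonneg_left h2 hκ0.le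
    rw [hκ] at h3 ⊢
    linarith
  have hpA : ∀ x, p (A x) = p x := fun x ↦ by
    rw [hAx, map_add, map_smul, map_smul, starProjection_ker_apply_eq_zero hT, smul_zero,
      add_zero, one_smul]
  have hpp : ∀ x, p (p x) = p x := fun x ↦
    P.ker.starProjection_eq_self_iff.2 (P.ker.starProjection_apply_mem x)
  -- the kernel is spanned by the invariance modes
  set D : EuclideanSpace ℝ (Fin s) →L[ℝ] H := (e : V →L[ℝ] H).comp (fderiv ℝ U c₀) with hD
  have hDle : P.ker ≤ (D : EuclideanSpace ℝ (Fin s) →ₗ[ℝ] H).range := by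
    intro x hx
    have hx' : T x = 0 := by
      have : P x = 0 := hx
      rwa [hPdef, neg_apply, neg_eq_zero] at this
    have h1 := (hker.kernel _).1 (linearized_eq_zero_of_energyL hM he hx')
    have h2 : Submodule.span ℝ (Set.range (invarianceMode U c₀))
        ≤ (fderiv ℝ U c₀ : EuclideanSpace ℝ (Fin s) →ₗ[ℝ] V).range := by
      rw [Submodule.span_le]
      rintro _ ⟨j, rfl⟩
      exact ⟨_, rfl⟩
    obtain ⟨c, hc⟩ := h2 h1
    refine ⟨c, ?_⟩
    have hc' : fderiv ℝ U c₀ c = e.symm x := hc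
    simp [hD, hc']
  have : FiniteDimensional ℝ P.ker := Submodule.finiteDimensional_of_le hDle
  -- A linear choice of parameters for each kernel vector. The invariance modes may be linearly
  -- dependent, so `D` is only lifted over the kernel, not inverted; the result `τ` satisfies `D ∘ τ
  -- = p`, which makes `W` tangent to the range of `p`.
  obtain ⟨σ, hσ⟩ := Module.projective_lifting_property
    (D : EuclideanSpace ℝ (Fin s) →ₗ[ℝ] H).rangeRestrict (Submodule.inclusion hDle)
    (LinearMap.surjective_rangeRestrict _)
  set τ : H →L[ℝ] EuclideanSpace ℝ (Fin s) :=
    (LinearMap.toContinuousLinearMap σ).comp P.ker.orthogonalProjectionOnto with hτ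
  have hDτ : D.comp τ = p := by
    ext x
    have h1 := DFunLike.congr_fun hσ (P.ker.orthogonalProjectionOnto x)
    have h2 := congrArg Subtype.val h1
    exact h2
  set W : H → H := fun x ↦ e (U (c₀ + τ x)) with hWdef
  have hW : HasStrictFDerivAt W p 0 := by
    have h1 : HasStrictFDerivAt (fun x : H ↦ c₀ + τ x) τ 0 := τ.hasStrictFDerivAt.const_add c₀
    have h2 : HasStrictFDerivAt U (fderiv ℝ U c₀) (c₀ + τ 0) := by
      rw [map_zero, add_zero]
      exact hker.contDiffAt.hasStrictFDerivAt one_ne_zero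
    have h3 := (e : V →L[ℝ] H).hasStrictFDerivAt.comp 0 (h2.comp 0 h1)
    rw [← hDτ]
    exact h3
  have hτ0 : Tendsto (fun x ↦ c₀ + τ x) (𝓝 0) (𝓝 c₀) := by
    have : Continuous fun x ↦ c₀ + τ x := by fun_prop
    simpa using this.tendsto 0
  have hsol : ∀ᶠ x in 𝓝 (0 : H), L₀ (U (c₀ + τ x)) = 0 := hτ0.eventually hker.solution
  have hfix : ∀ᶠ x in 𝓝 (0 : H), energyStep M L₀ e Δt (W x) = W x := by
    filter_upwards [hsol] with x hx using energyStep_eq_self Δt hx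
  obtain ⟨r, hr, K, hK, hstep⟩ := exists_norm_energyStep_sub_le (M := M) (e := e) hL₀ hu Δt
  have hF := hasStrictFDerivAt_of_norm_sub_le hr hK hstep
  intro ε hε
  have hτε : ∀ᶠ x in 𝓝 (0 : H), ‖c₀ + τ x - c₀‖ < ε := by
    have := hτ0.eventually (Metric.ball_mem_nhds c₀ hε)
    simpa only [Metric.mem_ball, dist_eq_norm] using this
  obtain ⟨r', hr', hball⟩ := Metric.eventually_nhds_iff.1 (hsol.and hτε)
  obtain ⟨B, hB, hBe⟩ := exists_bound_equiv e
  obtain ⟨B', hB', hBe'⟩ := exists_bound_equiv e.symm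
  obtain ⟨δ, hδ, hconv⟩ := tendsto_iterate_of_fixedPoints hF hW (by simp [hWdef]) hfix hpp hpA
    (Real.sqrt_nonneg _) hρ hA (ε := min r' (ε / B')) (by positivity)
  refine ⟨δ / B, by positivity, fun u₀ hu₀ ↦ ?_⟩
  rw [lt_div_iff₀ hB] at hu₀
  obtain ⟨h1, y, hy, hlim⟩ := hconv (e u₀) (by
    rw [← map_sub]; linarith [hBe (u₀ - U c₀)])
  simp only [energyStep_iterate] at h1 hlim
  obtain ⟨hy1, hy2⟩ := hball (y := y) (by
    rw [dist_zero_right]; exact hy.trans_le (min_le_left _ _))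
  refine ⟨fun n ↦ ?_, c₀ + τ y, hy2, hy1, ?_⟩
  · have h2 := (h1 n).trans_le (min_le_right _ _)
    rw [← map_sub, lt_div_iff₀ hB'] at h2
    have h3 := hBe' (e (iterate M L₀ Δt u₀ n - U c₀))
    rw [e.symm_apply_apply] at h3
    linarith
  · have := (e.symm.continuous.tendsto _).comp hlim
    simpa [Function.comp_def, hWdef] using this

theorem divergesFrom_of_lt {u : V} (hM : IsAcceleration M) (he : ∀ v w, ⟪e v, e w⟫ = M v w)
    (hL₀ : IsLinearizableNear L₀ u) (hu : L₀ u = 0) {l : ℝ}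
    (hl : IsLeast (spectrum ℝ (curlyL M L₀ u)) l) (hl0 : l < 0) {Δt : ℝ}
    (h0 : 0 < Δt) (hΔt : 2 < Δt * (-l)) : DivergesFrom M L₀ u Δt := by
  rw [← spectrum_energyL (e := e)] at hl
  set T := energyL M L₀ e u with hTdef
  have hT : (-T).IsPositive := isPositive_neg_energyL hM he _
  have hP := isPositive_sub_isLeast_spectrum hT hl
  have hPle := norm_sub_isLeast_spectrum_sq_le hT hl hl0
  set P : H →L[ℝ] H := T - algebraMap ℝ _ l with hPdef
  set κ : ℝ := -(1 + Δt * l) with hκ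
  have hκ1 : 1 < κ := by rw [hκ]; linarith
  have hAx : ∀ x, (1 + Δt • T) x = (-κ) • x + Δt • P x := fun x ↦ by
    rw [hκ, neg_neg]; exact one_add_smul_apply_eq T Δt l x
  -- Here `A = -κ + Δt P` with `0 ≤ P ≤ -l`. The coefficient of `⟪P x, x⟫` in the bound for `‖A x‖²`
  -- is `Δt (1 - κ) < 0`, so it may be dropped.
  have hA : ∀ x, ‖(1 + Δt • T) x‖ ≤ κ * ‖x‖ := fun x ↦ by
    refine le_of_sq_le_sq ?_ (by positivity)
    have h1 := norm_sq_smul_add_le hPle (-κ) Δt x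
    have h2 := hP.inner_nonneg_left x
    have h3 : Δt * (2 * -κ + Δt * -l) ≤ 0 :=
      mul_nonpos_of_nonneg_of_nonpos h0.le (by rw [hκ] at hκ1 ⊢; linarith)
    rw [hAx, mul_pow]
    linarith [mul_nonpos_of_nonpos_of_nonneg h3 h2]
  have hzero : (0 : ℝ) ∈ spectrum ℝ P := by
    rw [hPdef, mem_spectrum_sub_algebraMap, zero_add]; exact hl.1
  have happrox : ∀ ε > 0, ∃ v, ‖v‖ = 1 ∧ ‖(1 + Δt • T) v + κ • v‖ ≤ ε := fun ε hε ↦ by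
    obtain ⟨v, hv, hPv⟩ := exists_unit_norm_le_of_zero_mem_spectrum hP hzero
      (ε := ε / Δt) (by positivity)
    refine ⟨v, hv, ?_⟩
    have h1 : (1 + Δt • T) v + κ • v = Δt • P v := by rw [hAx]; module
    rw [h1, norm_smul, Real.norm_eq_abs, abs_of_pos h0]
    rwa [le_div_iff₀' h0] at hPv
  obtain ⟨r, hr, K, hK, hstep⟩ := exists_norm_energyStep_sub_le (M := M) (e := e) hL₀ hu Δt
  have hquad : ∀ x, ‖x - e u‖ < r →
      ‖energyStep M L₀ e Δt x - e u - (1 + Δt • T) (x - e u)‖ ≤ (K + 1) * ‖x - e u‖ ^ 2 := by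
    intro x hx
    have h1 := hstep x (e u) hx (by simpa using hr)
    rw [energyStep_eq_self Δt hu, sub_self, norm_zero, add_zero] at h1
    nlinarith [sq_nonneg ‖x - e u‖]
  obtain ⟨ε, hε, hdiv⟩ := exists_iterate_far_from_fixedPoints hκ1 hA happrox hr
    (show 0 < K + 1 by linarith) hquad
  obtain ⟨B, hB, hBe⟩ := exists_bound_equiv e
  obtain ⟨B', hB', hBe'⟩ := exists_bound_equiv e.symm
  refine ⟨ε / B, by positivity, fun δ hδ ↦ ?_⟩
  obtain ⟨x, hx, n, hn, hfar⟩ := hdiv (δ / B') (by positivity)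
  obtain ⟨u₀, rfl⟩ := e.surjective x
  rw [energyStep_iterate] at hn
  simp only [energyStep_iterate] at hfar
  have hback : ∀ v w : V, ε ≤ ‖e v - e w‖ → ε / B ≤ ‖v - w‖ := fun v w hvw ↦ by
    rw [div_le_iff₀' hB]
    refine hvw.trans ?_
    rw [← map_sub]
    exact hBe _
  refine ⟨u₀, ?_, n, hback _ _ hn, fun v hv ↦ hback _ _ (hfar _ (energyStep_eq_self Δt hv))⟩
  rw [← map_sub, lt_div_iff₀ hB'] at hx
  have := hBe' (e (u₀ - u))
  rw [e.symm_apply_apply] at this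
  linarith

theorem divergesGenericallyFrom_of_lt {u : V} (hM : IsAcceleration M)
    (he : ∀ v w, ⟪e v, e w⟫ = M v w) (hL₀ : IsLinearizableNear L₀ u) (hu : L₀ u = 0) {l : ℝ}
    (hl : IsLeast (spectrum ℝ (curlyL M L₀ u)) l) (hl0 : l < 0) {l' : ℝ} (hl' : l < l')
    (hgap : ∀ m ∈ spectrum ℝ (curlyL M L₀ u), m ≠ l → l' ≤ m) {Δt : ℝ}
    (h0 : 0 < Δt) (hΔt : 2 < Δt * (-l)) : DivergesGenericallyFrom M L₀ u Δt := by
  rw [← spectrum_energyL (e := e)] at hl hgap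
  set T := energyL M L₀ e u with hTdef
  have hT : (-T).IsPositive := isPositive_neg_energyL hM he _
  have hP := isPositive_sub_isLeast_spectrum hT hl
  have hPle := norm_sub_isLeast_spectrum_sq_le hT hl hl0
  have hzero : (0 : ℝ) ∈ spectrum ℝ (T - algebraMap ℝ (H →L[ℝ] H) l) := by
    rw [mem_spectrum_sub_algebraMap, zero_add]; exact hl.1
  have hgapP : ∀ m ∈ spectrum ℝ (T - algebraMap ℝ (H →L[ℝ] H) l), m ≠ 0 → l' - l ≤ m := by
    intro m hm hm0
    rw [mem_spectrum_sub_algebraMap] at hm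
    linarith [hgap _ hm (by simpa using hm0)]
  set P : H →L[ℝ] H := T - algebraMap ℝ _ l with hPdef
  set κ : ℝ := -(1 + Δt * l) with hκ
  have hκ1 : 1 < κ := by rw [hκ]; linarith
  have hAx : ∀ x, (1 + Δt • T) x = (-κ) • x + Δt • P x := fun x ↦ by
    rw [hκ, neg_neg]; exact one_add_smul_apply_eq T Δt l x
  obtain ⟨γ, hγ, hγP⟩ := exists_coercive_orthogonal_ker hP (sub_pos.2 hl') hgapP
  obtain ⟨e₀, he₀, hPe₀⟩ := exists_ker_ne_zero hP hzero (sub_pos.2 hl') hgapP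
  have : CompleteSpace P.ker := P.isClosed_ker.completeSpace_coe
  set p : H →L[ℝ] H := P.ker.starProjection with hpdef
  set A : H →L[ℝ] H := 1 + Δt • T with hAdef
  have hpA : ∀ x, p (A x) = (-κ) • p x := fun x ↦ by
    rw [hAx, map_add, map_smul, map_smul, starProjection_ker_apply_eq_zero hP, smul_zero,
      add_zero]
  have hAp : ∀ x, A (p x) = (-κ) • p x := fun x ↦ by
    rw [hAx, apply_starProjection_ker, smul_zero, add_zero]
  -- The term dropped in the ungapped case is now used: on the complement of the eigenspace,
  -- coercivity of `P` gives `‖A x‖² ≤ (κ² - c γ) ‖x‖²`.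
  set c : ℝ := Δt * (κ - 1) with hc
  have hc0 : 0 < c := mul_pos h0 (by linarith)
  have hρ : Real.sqrt (κ ^ 2 - c * γ) < κ := by
    rw [Real.sqrt_lt' (by linarith)]; linarith [mul_pos hc0 hγ]
  have hq : ∀ x, ‖A x - p (A x)‖ ≤ Real.sqrt (κ ^ 2 - c * γ) * ‖x - p x‖ := fun x ↦ by
    have h1 : A x - p (A x) = A (x - p x) := by rw [map_sub, hAp, hpA]
    rw [h1]
    refine norm_le_sqrt_mul_of_sq_le ?_
    have h2 := norm_sq_smul_add_le hPle (-κ) Δt (x - p x)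
    have h3 := mul_le_mul_of_nonneg_left
      (hγP (x - p x) (P.ker.sub_starProjection_mem_orthogonal x)) hc0.le
    have h4 : Δt * (2 * -κ + Δt * -l) = -c := by rw [hc, hκ]; ring
    rw [h4] at h2
    rw [hAx]
    linarith
  obtain ⟨r, hr, K, hK, hstep⟩ := exists_norm_energyStep_sub_le (M := M) (e := e) hL₀ hu Δt
  have hF := hasStrictFDerivAt_of_norm_sub_le hr hK hstep
  obtain ⟨ε, hε, hint⟩ := interior_setOf_iterate_near_eq_empty (p := p) hF hκ1 hρ
    (fun x ↦ by rw [hpA, norm_smul, norm_neg, Real.norm_eq_abs, abs_of_pos (by linarith)])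
    hq he₀ (P.ker.starProjection_eq_self_iff.2 hPe₀)
  obtain ⟨B, hB, hBe⟩ := exists_bound_equiv e
  refine ⟨ε / B, by positivity, ?_⟩
  rw [Set.eq_empty_iff_forall_notMem]
  intro v hv
  have hsub : {w : V | ∀ n, ‖iterate M L₀ Δt w n - u‖ < ε / B}
      ⊆ e ⁻¹' {x | ∀ n, ‖(energyStep M L₀ e Δt)^[n] x - e u‖ < ε} := by
    intro w hw n
    rw [energyStep_iterate, ← map_sub]
    have := hw n
    rw [lt_div_iff₀ hB] at this
    linarith [hBe (iterate M L₀ Δt w n - u)]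
  have h1 := interior_mono hsub hv
  have h2 : interior (e ⁻¹' {x | ∀ n, ‖(energyStep M L₀ e Δt)^[n] x - e u‖ < ε}) = ∅ := by
    have := e.toHomeomorph.preimage_interior {x | ∀ n, ‖(energyStep M L₀ e Δt)^[n] x - e u‖ < ε}
    rw [hint, Set.preimage_empty] at this
    exact this.symm
  rw [h2] at h1
  exact h1

end Transfer

end SquaredOperator

end

theorem theorem1 {V : Type*} [NormedAddCommGroup V] [InnerProductSpace ℝ V] [CompleteSpace V]
    -- the wave equation `L₀ u = 0` and the acceleration operator
    (L₀ : V → StrongDual ℝ V) (M : V ≃L[ℝ] StrongDual ℝ V)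
    (hM : SquaredOperator.IsAcceleration M)
    -- the family of solitary waves, the solitary wave `U c₀`, and the kernel of `L₁` there
    (s : ℕ) (U : EuclideanSpace ℝ (Fin s) → V) (c₀ : EuclideanSpace ℝ (Fin s))
    (hL₀ : SquaredOperator.IsLinearizableNear L₀ (U c₀))
    (hker : SquaredOperator.KernelAssumption L₀ U c₀)
    -- the smallest point of the spectrum of `𝓛`, and the maximal time step
    (Λmin : ℝ) (hΛ : IsLeast (spectrum ℝ (SquaredOperator.curlyL M L₀ (U c₀))) Λmin)
    (hΛ0 : Λmin ≠ 0)
    (Δtmax : ℝ) (hmax : Δtmax = -2 / Λmin) :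
    -- convergence, the nonzero spectrum of `𝓛` being bounded away from zero
    ((∃ Λmax < 0, ∀ Λ ∈ spectrum ℝ (SquaredOperator.curlyL M L₀ (U c₀)), Λ ≠ 0 → Λ ≤ Λmax) →
      ∀ Δt : ℝ, 0 < Δt → Δt < Δtmax → SquaredOperator.ConvergesNear M L₀ U c₀ Δt) ∧
    -- divergence
    (∀ Δt : ℝ, Δtmax < Δt → SquaredOperator.DivergesFrom M L₀ (U c₀) Δt) ∧
    -- divergence for generic initial conditions, `Λmin` being isolated in the spectrum of `𝓛`
    ((∃ Λ' > Λmin, ∀ Λ ∈ spectrum ℝ (SquaredOperator.curlyL M L₀ (U c₀)), Λ ≠ Λmin → Λ' ≤ Λ) →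
      ∀ Δt : ℝ, Δtmax < Δt → SquaredOperator.DivergesGenericallyFrom M L₀ (U c₀) Δt) := by
  obtain ⟨H, _, _, _, e, he⟩ := hM.exists_hilbertSpace
  have hu : L₀ (U c₀) = 0 := hker.solution.self_of_nhds
  have hneg : Λmin < 0 := SquaredOperator.neg_of_mem_spectrum
    (SquaredOperator.isPositive_neg_energyL hM he (U c₀))
    (by rw [SquaredOperator.spectrum_energyL]; exact hΛ.1) hΛ0
  have hneg' : 0 < -Λmin := neg_pos.2 hneg
  have hmax' : Δtmax = 2 / (-Λmin) := by rw [hmax, div_neg, neg_div]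
  have hmax0 : 0 < Δtmax := by rw [hmax']; positivity
  have hlarge : ∀ Δt, Δtmax < Δt → 2 < Δt * (-Λmin) := fun Δt hΔt ↦ by
    rwa [hmax', div_lt_iff₀ hneg'] at hΔt
  refine ⟨?_, fun Δt hΔt ↦ ?_, ?_⟩
  · rintro ⟨Λmax, hΛmax, hgap⟩ Δt h0 hΔt
    rw [hmax', lt_div_iff₀ hneg'] at hΔt
    exact SquaredOperator.convergesNear_of_lt hM he hL₀ hker hΛ hneg hΛmax hgap h0 hΔt
  · exact SquaredOperator.divergesFrom_of_lt hM he hL₀ hu hΛ hneg (hmax0.trans hΔt)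
      (hlarge Δt hΔt)
  · rintro ⟨Λ', hΛ', hgap⟩ Δt hΔt
    exact SquaredOperator.divergesGenericallyFrom_of_lt hM he hL₀ hu hΛ hneg hΛ' hgap
      (hmax0.trans hΔt) (hlarge Δt hΔt)
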